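/- Let $\mathbb K$ be a field of characteristic $0$ and $R=\mathbb K[x_1,\dots,x_n]$ with the variables ordered $x_1<\cdots<x_n$. For $F\in R\setminus\mathbb K$, the leading variable $\mathrm{lv}(F)$ is the greatest variable occurring in $F$, and the initial $\mathrm{ini}(F)$ is the leading coefficient of $F$ regarded as a polynomial in $\mathrm{lv}(F)$. A (nontrivial) triangular set is a finite nonempty ordered set $[T_1,\dots,T_r]$ of polynomials in $R\setminus\mathbb K$ with $\mathrm{lv}(T_1)<\cdots<\mathrm{lv}(T_r)$; in addition $[c]$ with $c\in\mathbb K\setminus\{0\}$ is considered as a trivial triangular set. The saturated ideal of a nontrivial triangular set $\mathcal T=[T_1,\dots,T_r]$ is $$\mathrm{sat}(\mathcal T)=\{P\in R:\ P\,J^{i}\in\langle T_1,\dots,T_r\rangle\text{ for some } i\ge 0\},\qquad J=\mathrm{ini}(T_1)\cdots\mathrm{ini}(T_r),$$ and $\mathrm{sat}([c])=\langle 1\rangle$. A nontrivial triangular set $[T_1,\dots,T_r]$ is regular if, for every $i=1,\dots,r$, the initial $\mathrm{ini}(T_i)$ is neither zero nor a zero-divisor in $R/\mathrm{sat}([T_1,\dots,T_{i-1}])$,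 where $\mathrm{sat}([\,])=\langle 0\rangle$; trivial triangular sets are not counted as regular. The W-characteristic set of an ideal $\mathfrak I\subseteq R$ is the subset of the reduced Gröbner basis $\mathcal G$ of $\mathfrak I$, with respect to the lexicographic term order with $x_1<\cdots<x_n$, that consists of the element of $\mathcal G\cap\mathbb K$, if there is one, and, for every $i$ for which $\mathcal G$ has elements with leading variable $x_i$, of the smallest (with respect to the term order) of these elements, ordered by increasing leading variable. Let $\mathcal T$ be a triangular set such that every variable which is not the leading variable of an element of $\mathcal T$ is smaller than all the leading variables of the elements of $\mathcal T$. Let $\mathcal C$ be the W-characteristic set of $\mathrm{sat}(\mathcal T)$. Then $\mathrm{sat}(\mathcal T)$ is equiprojectable, i.e. $\mathrm{sat}(\mathcal T)=\mathrm{sat}(\bar{\mathcal T})$ for some regular triangular set $\bar{\mathcal T}$ (with respect to the same variable ordering), if and only if $\mathcal C$ is regular and $\mathrm{sat}(\mathcal T)=\mathrm{sat}(\mathcal C)$. -/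

import Mathlib

open MvPolynomial
open scoped MonomialOrder

namespace TriSet

noncomputable section

/-! ### Reduced Gröbner bases -/

section Groebner

variable {σ K : Type*} [Field K]

/-- The finite set `G ⊆ I` is a Gröbner basis of the ideal `I` for the term order `m`:
the leading terms of the elements of `G` generate the ideal generated by the leading terms of
all the elements of `I`. -/
def IsGroebnerBasis (m : MonomialOrder σ) (I : Ideal (MvPolynomial σ K))
    (G : Finset (MvPolynomial σ K)) : Prop :=
  (∀ g ∈ G, g ∈ I) ∧
    Ideal.span (m.leadingTerm '' (G : Set (MvPolynomial σ K))) =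
      Ideal.span (m.leadingTerm '' (I : Set (MvPolynomial σ K)))

/-- The Gröbner basis `G` is reduced: its elements are monic, and no term of an element of `G` is
divisible by the leading term of another element of `G`. -/
def IsReducedGroebnerBasis (m : MonomialOrder σ) (I : Ideal (MvPolynomial σ K))
    (G : Finset (MvPolynomial σ K)) : Prop :=
  IsGroebnerBasis m I G ∧ (∀ g ∈ G, m.Monic g) ∧
    ∀ g ∈ G, ∀ h ∈ G, h ≠ g → ∀ c ∈ g.support, ¬ m.degree h ≤ c

theorem IsReducedGroebnerBasis.exists_degree_le {m : MonomialOrder σ}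
    {I : Ideal (MvPolynomial σ K)} {G : Finset (MvPolynomial σ K)}
    (hG : IsReducedGroebnerBasis m I G) {f : MvPolynomial σ K} (hf : f ∈ I) (h0 : f ≠ 0) :
    ∃ g ∈ G, m.degree g ≤ m.degree f := by
  have h1 : m.leadingTerm f ∈
      Ideal.span (m.leadingTerm '' (G : Set (MvPolynomial σ K))) := by
    rw [hG.1.2]
    exact Ideal.subset_span ⟨f, hf, rfl⟩
  have h2 : m.leadingTerm '' (G : Set (MvPolynomial σ K)) =
      (fun s => monomial s (1 : K)) '' (m.degree '' (G : Set (MvPolynomial σ K))) := by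
    rw [Set.image_image]
    refine Set.image_congr fun g hg => ?_
    rw [MonomialOrder.leadingTerm, (hG.2.1 g hg).leadingCoeff_eq_one]
  rw [h2, mem_ideal_span_monomial_image] at h1
  obtain ⟨_, ⟨g, hg, rfl⟩, hle⟩ := h1 (m.degree f) (by
    rw [m.support_leadingTerm' h0]; simp)
  exact ⟨g, hg, hle⟩

theorem IsReducedGroebnerBasis.subset {m : MonomialOrder σ}
    {I : Ideal (MvPolynomial σ K)} {G G' : Finset (MvPolynomial σ K)}
    (hG : IsReducedGroebnerBasis m I G) (hG' : IsReducedGroebnerBasis m I G') : G ⊆ G' := by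
  classical
  have key : ∀ {H : Finset (MvPolynomial σ K)}, IsReducedGroebnerBasis m I H →
      ∀ h ∈ H, ∀ p ∈ I, p ≠ 0 → m.degree p ∈ h.support → m.degree p = m.degree h := by
    intro H hH h hh p hp p0 hs
    obtain ⟨q, hq, hle⟩ := hH.exists_degree_le hp p0
    by_cases hqh : q = h
    · subst hqh
      exact m.toSyn.injective (le_antisymm (m.le_degree hs) (m.toSyn_monotone hle))
    · exact absurd hle (hH.2.2 h hh q hq hqh _ hs)
  intro g hg
  have hgI := hG.1.1 g hg
  have g0 : g ≠ 0 := (hG.2.1 g hg).ne_zero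
  obtain ⟨g', hg', h1⟩ := hG'.exists_degree_le hgI g0
  have hgI' := hG'.1.1 g' hg'
  have g0' : g' ≠ 0 := (hG'.2.1 g' hg').ne_zero
  obtain ⟨g'', hg'', h2⟩ := hG.exists_degree_le hgI' g0'
  have hgg : g'' = g := by
    by_contra hne
    exact hG.2.2 g hg g'' hg'' hne _ (m.degree_mem_support g0) (h2.trans h1)
  subst hgg
  have hd : m.degree g' = m.degree g'' := le_antisymm h1 h2
  suffices hz : g'' - g' = 0 by rwa [sub_eq_zero.1 hz]
  by_contra hz
  have hI : g'' - g' ∈ I := I.sub_mem hgI hgI'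
  have hmem := m.degree_mem_support hz
  have hne : m.degree (g'' - g') ≠ m.degree g'' := by
    intro he
    rw [he, mem_support_iff, coeff_sub, (hG.2.1 _ hg).coeff_degree, ← hd,
      (hG'.2.1 _ hg').coeff_degree] at hmem
    simp at hmem
  rcases Finset.mem_union.1 (support_sub _ _ _ hmem) with h | h
  · exact hne (key hG _ hg _ hI hz h)
  · exact hne ((key hG' _ hg' _ hI hz h).trans hd)

/-- Every ideal has exactly one reduced Gröbner basis. -/
theorem existsUnique_isReducedGroebnerBasis [Finite σ] (m : MonomialOrder σ)
    (I : Ideal (MvPolynomial σ K)) : ∃! G, IsReducedGroebnerBasis m I G := by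
  classical
  have hex : ∃ G, IsReducedGroebnerBasis m I G := by
    set S : Set (σ →₀ ℕ) := {d | ∃ f ∈ I, f ≠ 0 ∧ m.degree f = d} with hS
    have hup : ∀ d ∈ S, ∀ e, d ≤ e → e ∈ S := by
      rintro d ⟨f, hf, f0, rfl⟩ e hle
      have hm : (monomial (e - m.degree f) (1 : K)) ≠ 0 := by simp
      refine ⟨monomial (e - m.degree f) 1 * f, I.mul_mem_left _ hf, mul_ne_zero hm f0, ?_⟩
      rw [m.degree_mul hm f0, m.degree_monomial, if_neg one_ne_zero, tsub_add_cancel_of_le hle]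
    have hfin : {d | Minimal (· ∈ S) d}.Finite :=
      WellQuasiOrderedLE.finite_of_isAntichain (setOfPred_minimal_antichain _)
    have hbelow : ∀ d ∈ S, ∃ e ≤ d, Minimal (· ∈ S) e := fun d hd =>
      exists_minimal_le_of_wellFoundedLT (· ∈ S) d hd
    have hpoly : ∀ d ∈ S, ∃ f ∈ I, m.Monic f ∧ m.degree f = d ∧
        ∀ c ∈ f.support, c ∈ S → c = d := by
      rintro d ⟨f, hf, f0, hfd⟩
      obtain ⟨q, r, hq, -, hr⟩ := m.div_set (B := {b | b ∈ I ∧ b ≠ 0})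
        (fun b hb => by
          rw [isUnit_iff_ne_zero, Ne, m.leadingCoeff_eq_zero_iff]; exact hb.2)
        (C (m.leadingCoeff f)⁻¹ * f - monomial d 1)
      have hrS : ∀ c ∈ r.support, c ∉ S := by
        rintro c hc ⟨b, hb, b0, rfl⟩
        exact hr _ hc b ⟨hb, b0⟩ le_rfl
      have hmem : monomial d 1 + r ∈ I := by
        have : monomial d 1 + r = C (m.leadingCoeff f)⁻¹ * f -
            Finsupp.linearCombination (MvPolynomial σ K)
              (fun b : {b | b ∈ I ∧ b ≠ 0} => (b : MvPolynomial σ K)) q := by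
          linear_combination - hq
        rw [this]
        refine I.sub_mem (I.mul_mem_left _ hf) ?_
        rw [Finsupp.linearCombination_apply]
        exact I.sum_mem fun b _ => I.mul_mem_left _ b.2.1
      have hdS : d ∈ S := ⟨f, hf, f0, hfd⟩
      have hrd : coeff d r = 0 := by
        by_contra h
        exact hrS d (mem_support_iff.2 h) hdS
      have hcd : coeff d (monomial d 1 + r) = 1 := by simp [hrd]
      have hsup : ∀ c ∈ (monomial d (1 : K) + r).support, c ∈ S → c = d := by
        intro c hc hcS
        by_contra hne
        refine hrS c ?_ hcS
        rw [mem_support_iff, coeff_add, coeff_monomial, if_neg (Ne.symm hne), zero_add] at hc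
        exact mem_support_iff.2 hc
      have hne0 : monomial d (1 : K) + r ≠ 0 := by
        intro h
        rw [h] at hcd
        simp at hcd
      have hdeg : m.degree (monomial d (1 : K) + r) = d :=
        hsup _ (m.degree_mem_support hne0) ⟨_, hmem, hne0, rfl⟩
      refine ⟨_, hmem, ?_, hdeg, hsup⟩
      rw [MonomialOrder.Monic, MonomialOrder.leadingCoeff, hdeg, hcd]
    choose! F hFI hFm hFd hFs using hpoly
    refine ⟨hfin.toFinset.image F, ⟨?_, ?_⟩, ?_, ?_⟩
    · intro g hg
      obtain ⟨d, hd, rfl⟩ := Finset.mem_image.1 hg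
      exact hFI d ((hfin.mem_toFinset).1 hd).1
    · apply le_antisymm
      · apply Ideal.span_mono
        apply Set.image_mono
        intro g hg
        obtain ⟨d, hd, rfl⟩ := Finset.mem_image.1 (Finset.mem_coe.1 hg)
        exact hFI d ((hfin.mem_toFinset).1 hd).1
      · rw [Ideal.span_le]
        rintro _ ⟨f, hf, rfl⟩
        by_cases f0 : f = 0
        · rw [f0, m.leadingTerm_zero]
          exact Ideal.zero_mem _
        obtain ⟨e, hle, he⟩ := hbelow (m.degree f) ⟨f, hf, f0, rfl⟩
        have hlt : m.leadingTerm f = monomial (m.degree f - e) (m.leadingCoeff f) *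
            m.leadingTerm (F e) := by
          rw [MonomialOrder.leadingTerm, MonomialOrder.leadingTerm, hFd e he.1,
            (hFm e he.1).leadingCoeff_eq_one, monomial_mul, mul_one, tsub_add_cancel_of_le hle]
        rw [SetLike.mem_coe, hlt]
        refine Ideal.mul_mem_left _ _ (Ideal.subset_span ⟨F e, ?_, rfl⟩)
        exact Finset.mem_coe.2 (Finset.mem_image.2 ⟨e, (hfin.mem_toFinset).2 he, rfl⟩)
    · intro g hg
      obtain ⟨d, hd, rfl⟩ := Finset.mem_image.1 hg
      exact hFm d ((hfin.mem_toFinset).1 hd).1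
    · intro g hg h hh hne c hc hle
      obtain ⟨d, hd, rfl⟩ := Finset.mem_image.1 hg
      obtain ⟨e, he, rfl⟩ := Finset.mem_image.1 hh
      have hd' := (hfin.mem_toFinset).1 hd
      have he' := (hfin.mem_toFinset).1 he
      rw [hFd e he'.1] at hle
      have hcd := hFs d hd'.1 c hc (hup e he'.1 c hle)
      subst hcd
      exact hne (by rw [le_antisymm hle (hd'.2 he'.1 hle)])
  obtain ⟨G, hG⟩ := hex
  exact ⟨G, hG, fun G' hG' => Finset.Subset.antisymm (hG'.subset hG) (hG.subset hG')⟩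

/-- The reduced Gröbner basis of `I` for the term order `m`. -/
def reducedGroebnerBasis [Finite σ] (m : MonomialOrder σ) (I : Ideal (MvPolynomial σ K)) :
    Finset (MvPolynomial σ K) :=
  (existsUnique_isReducedGroebnerBasis m I).choose

theorem reducedGroebnerBasis_spec [Finite σ] (m : MonomialOrder σ)
    (I : Ideal (MvPolynomial σ K)) :
    IsReducedGroebnerBasis m I (reducedGroebnerBasis m I) :=
  (existsUnique_isReducedGroebnerBasis m I).choose_spec.1

end Groebner

/-! ### The lexicographic term order with `x₁ < ⋯ < xₙ` -/

/-- The lexicographic term order on the monomials in the variables `X 0 < X 1 < ⋯ < X (n-1)`.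
(`MonomialOrder.lex` takes `X 0` as the greatest variable, hence `Colex`.) -/
def lexOrder (n : ℕ) : MonomialOrder (Fin n) where
  syn := Colex (Fin n →₀ ℕ)
  toSyn :=
  { toEquiv := toColex
    map_add' := toColex_add }
  toSyn_monotone := Finsupp.toColex_monotone

/-- `a` is lexicographically smaller than `b` iff `a` has the smaller exponent at the greatest
variable where they differ. -/
theorem lexOrder_lt_iff {n : ℕ} {a b : Fin n →₀ ℕ} :
    a ≺[lexOrder n] b ↔ ∃ i, (∀ j, i < j → a j = b j) ∧ a i < b i :=
  Finsupp.Colex.lt_iff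

/-! ### Triangular sets -/

section Triangular

variable {K : Type*} [Field K] {n : ℕ}

/-- The leading variable of `P`: the greatest variable that occurs in `P`. It is `⊥` exactly when
`P` is a constant. -/
def leadVar (P : MvPolynomial (Fin n) K) : WithBot (Fin n) := P.vars.max

/-- The coefficient of `(X i) ^ k` in `P`, where `P` is regarded as a polynomial in `X i`. -/
def coeffIn (i : Fin n) (k : ℕ) (P : MvPolynomial (Fin n) K) : MvPolynomial (Fin n) K :=
  ∑ d ∈ P.support with d i = k, monomial (d.erase i) (P.coeff d)

/-- The initial of `P`: the leading coefficient of `P` with respect to its leading variable.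
(By convention it is `P` itself if `P` is a constant.) -/
def initial (P : MvPolynomial (Fin n) K) : MvPolynomial (Fin n) K :=
  if h : P.vars.Nonempty then coeffIn (P.vars.max' h) (P.degreeOf (P.vars.max' h)) P else P

/-- A (nontrivial) triangular set `[T₁, …, Tᵣ]`: finitely many, but at least one, nonconstant
polynomials with `lv T₁ < ⋯ < lv Tᵣ`. As the leading variables have to be distinct and fix the
ordering, it is given by its underlying finite set. -/
def IsTriangularSet (T : Finset (MvPolynomial (Fin n) K)) : Prop :=
  T.Nonempty ∧ (∀ P ∈ T, leadVar P ≠ ⊥) ∧ ∀ P ∈ T, ∀ Q ∈ T, leadVar P = leadVar Q → P = Q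

/-- A trivial triangular set `[c]`, where `c` is a nonzero constant. -/
def IsTrivialTriangularSet (T : Finset (MvPolynomial (Fin n) K)) : Prop :=
  ∃ c : K, c ≠ 0 ∧ T = {C c}

/-- The saturated ideal of `T`: all the `P` for which `P * J ^ i` is in the ideal generated by `T`
for some `i`, where `J` is the product of the initials of the elements of `T`.
It is the unit ideal for a trivial triangular set, and the zero ideal for the empty set. -/
def sat (T : Finset (MvPolynomial (Fin n) K)) : Ideal (MvPolynomial (Fin n) K) where
  carrier := {P | ∃ i : ℕ, P * (∏ Q ∈ T, initial Q) ^ i ∈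
    Ideal.span (T : Set (MvPolynomial (Fin n) K))}
  zero_mem' := ⟨0, by simp⟩
  add_mem' := by
    rintro P Q ⟨i, hi⟩ ⟨j, hj⟩
    refine ⟨i + j, ?_⟩
    have h : (P + Q) * (∏ Q ∈ T, initial Q) ^ (i + j) =
        (∏ Q ∈ T, initial Q) ^ j * (P * (∏ Q ∈ T, initial Q) ^ i) +
        (∏ Q ∈ T, initial Q) ^ i * (Q * (∏ Q ∈ T, initial Q) ^ j) := by ring
    rw [h]
    exact Ideal.add_mem _ (Ideal.mul_mem_left _ _ hi) (Ideal.mul_mem_left _ _ hj)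
  smul_mem' := by
    rintro A P ⟨i, hi⟩
    exact ⟨i, by rw [smul_eq_mul, mul_assoc]; exact Ideal.mul_mem_left _ _ hi⟩

/-- A regular set (regular chain): a nontrivial triangular set `[T₁, …, Tᵣ]` such that, for each
`i`, the initial of `Tᵢ` is neither zero nor a zero-divisor modulo `sat [T₁, …, Tᵢ₋₁]`.
Here `[T₁, …, Tᵢ₋₁]` is the set of the elements with leading variable below that of `Tᵢ`. -/
def IsRegularSet (T : Finset (MvPolynomial (Fin n) K)) : Prop :=
  IsTriangularSet T ∧ ∀ P ∈ T,
    Ideal.Quotient.mk (sat {Q ∈ T | leadVar Q < leadVar P}) (initial P) ≠ 0 ∧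
    Ideal.Quotient.mk (sat {Q ∈ T | leadVar Q < leadVar P}) (initial P) ∈
      nonZeroDivisors (MvPolynomial (Fin n) K ⧸ sat {Q ∈ T | leadVar Q < leadVar P})

/-- The W-characteristic set of `I`: from the reduced lexicographic Gröbner basis of `I` one takes,
for each leading variable that occurs in it, the smallest element with that leading variable.
(It is `{1}` for the unit ideal and empty for the zero ideal.) -/
def wCharSet (I : Ideal (MvPolynomial (Fin n) K)) : Finset (MvPolynomial (Fin n) K) :=
  {P ∈ reducedGroebnerBasis (lexOrder n) I |
    ∀ Q ∈ reducedGroebnerBasis (lexOrder n) I, leadVar Q = leadVar P →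
      (lexOrder n).degree P ≼[lexOrder n] (lexOrder n).degree Q}

/-- The variable ordering condition: every parameter of `T` (a variable that is not the leading
variable of an element of `T`) is smaller than every leading variable of an element of `T`. -/
def VariableOrderingCondition (T : Finset (MvPolynomial (Fin n) K)) : Prop :=
  ∀ i j : Fin n, (∀ P ∈ T, leadVar P ≠ i) → (∃ P ∈ T, leadVar P = j) → i < j

/-- The ideal `I` is equiprojectable: it is the saturated ideal of a regular set. -/
def IsEquiprojectable (I : Ideal (MvPolynomial (Fin n) K)) : Prop :=
  ∃ T : Finset (MvPolynomial (Fin n) K), IsRegularSet T ∧ I = sat T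

end Triangular

end

end TriSet

namespace TriSet

noncomputable section

variable {K : Type*} [Field K] {n : ℕ}

/-! If `sat T = sat T'` with `T'` regular, both sets have the same parameters
(`IsRegularSet.params_eq`), so `T'` inherits the ordering condition and `T` may be taken regular.
The converse is immediate: the W-characteristic set is itself a regular set with the right saturated
ideal.

Let `T` be regular, `I = sat T`, and let `t ∈ T` have leading variable `X j` and degree `d` in it.
Modulo `I`, the initial of `t` is regular and algebraic over the polynomials in the parameters, so
it divides a nonzero parameter polynomial `h`. Hence `I` contains a polynomial of degree `d` in `X
j` with initial `h` (`exists_mem_sat_degree`). On the other hand, an element of `I` in the variables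
up to `X j` and of degree `< d` in `X j` has all its coefficients in `I`
(`IsRegularSet.coeff_toPoly_mem_sat`), so no element of the reduced Gröbner basis with leading
variable `X j` has degree below `d`. Since the parameters are the smallest variables, lexicographic
minimality forces the element `c` of the W-characteristic set with leading variable `X j` to have
degree `d` and an initial in the parameters alone (`IsRegularSet.wCharSet_spec`).

A nonzero polynomial in the parameters is regular modulo the saturated ideal of any triangular set
(`regularModulo_sat`). So the W-characteristic set is regular, and its saturated ideal lies in `I`.
For the reverse inclusion, pseudo-divide an element of `I` by `c`: the remainder has degree `< d`,
so its coefficients lie in `I` and involve only smaller variables, and induction applies. -/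

/-! ### Polynomials regarded as univariate polynomials in one of the variables -/

/-- `P` regarded as a polynomial in `X j` (with coefficients in the same ring). -/
def toPoly (j : Fin n) :
    MvPolynomial (Fin n) K →ₐ[K] Polynomial (MvPolynomial (Fin n) K) :=
  aeval fun i => if i = j then Polynomial.X else Polynomial.C (X i)

theorem toPoly_monomial (j : Fin n) (d : Fin n →₀ ℕ) (a : K) :
    toPoly j (monomial d a) = Polynomial.monomial (d j) (monomial (d.erase j) a) := by
  have h1 : (d.prod fun i k => (if i = j then (Polynomial.X : Polynomial (MvPolynomial (Fin n) K))
      else Polynomial.C (X i)) ^ k) =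
      Polynomial.X ^ d j * Polynomial.C ((d.erase j).prod fun i k => X i ^ k) := by
    rw [← Finsupp.mul_prod_erase' d j _ (fun i => pow_zero _), map_finsuppProd]
    congr 1
    · simp
    · refine Finsupp.prod_congr fun i hi => ?_
      have : i ≠ j := by
        rintro rfl
        simp at hi
      simp [this]
  rw [toPoly, aeval_monomial, h1, monomial_eq, ← Polynomial.C_mul_X_pow_eq_monomial,
    Polynomial.C_mul, Polynomial.algebraMap_apply, MvPolynomial.algebraMap_eq]
  ring

theorem coeff_toPoly (j : Fin n) (k : ℕ) (P : MvPolynomial (Fin n) K) :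
    (toPoly j P).coeff k = coeffIn j k P := by
  conv_lhs => rw [P.as_sum]
  rw [map_sum, Polynomial.finsetSum_coeff, coeffIn, Finset.sum_filter]
  refine Finset.sum_congr rfl fun d _ => ?_
  rw [toPoly_monomial, Polynomial.coeff_monomial]

theorem eval_toPoly (j : Fin n) (P : MvPolynomial (Fin n) K) :
    (toPoly j P).eval (X j) = P := by
  induction P using MvPolynomial.induction_on with
  | C a => simp [toPoly]
  | add p q hp hq => rw [map_add, Polynomial.eval_add, hp, hq]
  | mul_X p i hp =>
    rw [map_mul, Polynomial.eval_mul, hp]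
    by_cases h : i = j <;> simp [toPoly, h]

theorem toPoly_X (j : Fin n) : toPoly (K := K) j (X j) = Polynomial.X := by simp [toPoly]

theorem toPoly_eq_C {j : Fin n} {P : MvPolynomial (Fin n) K} (h : j ∉ P.vars) :
    toPoly j P = Polynomial.C P := by
  rw [P.as_sum, map_sum, map_sum]
  refine Finset.sum_congr rfl fun d hd => ?_
  have hj : d j = 0 := mem_support_notMem_vars_zero hd h
  rw [toPoly_monomial, hj, Polynomial.monomial_zero_left,
    Finsupp.erase_of_notMem_support (by simpa using hj)]

theorem coeff_coeffIn (j : Fin n) (k : ℕ) (P : MvPolynomial (Fin n) K) (s : Fin n →₀ ℕ) :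
    (coeffIn j k P).coeff s = if s j = 0 then P.coeff (s + Finsupp.single j k) else 0 := by
  rw [coeffIn, Finset.sum_filter, coeff_sum]
  have hkey : ∀ d : Fin n →₀ ℕ, (d j = k ∧ d.erase j = s) ↔
      (s j = 0 ∧ d = s + Finsupp.single j k) := by
    intro d
    constructor
    · rintro ⟨rfl, rfl⟩
      exact ⟨by simp, (Finsupp.erase_add_single j d).symm⟩
    · rintro ⟨h0, rfl⟩
      refine ⟨by simp [h0], ?_⟩
      ext i
      by_cases hi : i = j
      · subst hi; simp [h0]
      · simp [Finsupp.erase_ne hi]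
  have hterm : ∀ d ∈ P.support,
      (if d j = k then monomial (d.erase j) (P.coeff d) else 0).coeff s =
      if d = s + Finsupp.single j k then (if s j = 0 then P.coeff d else 0) else 0 := by
    intro d _
    have := hkey d
    split_ifs with h1 h2 h3 h3 h2 <;> simp only [coeff_monomial, coeff_zero] <;>
      (try split_ifs) <;> tauto
  rw [Finset.sum_congr rfl hterm, Finset.sum_ite_eq']
  by_cases hs : s + Finsupp.single j k ∈ P.support
  · simp [hs]
  · rw [if_neg hs]
    rw [notMem_support_iff] at hs
    simp [hs]

theorem add_single_mem_support_of_mem_support_coeffIn {j : Fin n} {k : ℕ}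
    {P : MvPolynomial (Fin n) K} {s : Fin n →₀ ℕ} (h : s ∈ (coeffIn j k P).support) :
    s j = 0 ∧ s + Finsupp.single j k ∈ P.support := by
  rw [mem_support_iff, coeff_coeffIn] at h
  by_cases h0 : s j = 0
  · rw [if_pos h0] at h
    exact ⟨h0, mem_support_iff.2 h⟩
  · rw [if_neg h0] at h
    exact absurd rfl h

theorem notMem_vars_coeffIn (j : Fin n) (k : ℕ) (P : MvPolynomial (Fin n) K) :
    j ∉ (coeffIn j k P).vars := by
  rw [mem_vars_iff_mem_support]
  rintro ⟨s, hs, hj⟩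
  exact (Finsupp.mem_support_iff.1 hj) (add_single_mem_support_of_mem_support_coeffIn hs).1

theorem vars_coeffIn_subset (j : Fin n) (k : ℕ) (P : MvPolynomial (Fin n) K) :
    (coeffIn j k P).vars ⊆ P.vars := by
  intro i hi
  rw [mem_vars_iff_mem_support] at hi ⊢
  obtain ⟨s, hs, hi⟩ := hi
  refine ⟨_, (add_single_mem_support_of_mem_support_coeffIn hs).2, ?_⟩
  rw [Finsupp.mem_support_iff] at hi ⊢
  rw [Finsupp.add_apply]
  lia

theorem coeffIn_ne_zero_iff {j : Fin n} {k : ℕ} {P : MvPolynomial (Fin n) K} :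
    coeffIn j k P ≠ 0 ↔ ∃ d ∈ P.support, d j = k := by
  constructor
  · intro h
    obtain ⟨s, hs⟩ := support_nonempty.2 h
    obtain ⟨h0, h1⟩ := add_single_mem_support_of_mem_support_coeffIn hs
    exact ⟨_, h1, by simp [h0]⟩
  · rintro ⟨d, hd, rfl⟩ h
    have := coeff_coeffIn j (d j) P (d.erase j)
    rw [h, Finsupp.erase_add_single] at this
    simp at this
    exact (mem_support_iff.1 hd) this.symm

theorem natDegree_toPoly (j : Fin n) (P : MvPolynomial (Fin n) K) :
    (toPoly j P).natDegree = degreeOf j P := by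
  apply le_antisymm
  · rw [Polynomial.natDegree_le_iff_coeff_eq_zero]
    intro N hN
    rw [coeff_toPoly]
    by_contra h
    obtain ⟨d, hd, rfl⟩ := coeffIn_ne_zero_iff.1 h
    exact absurd (monomial_le_degreeOf j hd) (by lia)
  · rw [degreeOf_le_iff]
    intro d hd
    apply Polynomial.le_natDegree_of_ne_zero
    rw [coeff_toPoly]
    exact coeffIn_ne_zero_iff.2 ⟨d, hd, rfl⟩

theorem leadingCoeff_toPoly (j : Fin n) (P : MvPolynomial (Fin n) K) :
    (toPoly j P).leadingCoeff = coeffIn j (degreeOf j P) P := by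
  rw [Polynomial.leadingCoeff, natDegree_toPoly, coeff_toPoly]

/-! ### Leading variables and initials -/

theorem leadVar_eq_coe_iff {P : MvPolynomial (Fin n) K} {j : Fin n} :
    leadVar P = j ↔ j ∈ P.vars ∧ ∀ i ∈ P.vars, i ≤ j := by
  rw [leadVar]
  constructor
  · intro h
    exact ⟨Finset.mem_of_max h, fun i hi => Finset.le_max_of_eq hi h⟩
  · rintro ⟨h1, h2⟩
    apply le_antisymm
    · exact Finset.max_le fun i hi => WithBot.coe_le_coe.2 (h2 i hi)
    · exact Finset.le_max h1

theorem initial_eq {P : MvPolynomial (Fin n) K} {j : Fin n} (h : leadVar P = j) :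
    initial P = (toPoly j P).leadingCoeff := by
  have hne : P.vars.Nonempty := ⟨j, (leadVar_eq_coe_iff.1 h).1⟩
  have hj : P.vars.max' hne = j := by
    rw [leadVar, ← Finset.coe_max' hne] at h
    exact WithBot.coe_injective h
  rw [initial, dif_pos hne, hj, leadingCoeff_toPoly]

theorem initial_eq_coeffIn {P : MvPolynomial (Fin n) K} {j : Fin n} (h : leadVar P = j) :
    initial P = coeffIn j (degreeOf j P) P := by
  rw [initial_eq h, leadingCoeff_toPoly]

theorem vars_initial_subset (P : MvPolynomial (Fin n) K) : (initial P).vars ⊆ P.vars := by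
  rw [initial]
  split_ifs with h
  · exact vars_coeffIn_subset _ _ _
  · exact subset_rfl

theorem notMem_vars_initial {P : MvPolynomial (Fin n) K} {j : Fin n} (h : leadVar P = j) :
    j ∉ (initial P).vars := by
  rw [initial_eq_coeffIn h]
  exact notMem_vars_coeffIn _ _ _

theorem lt_of_mem_vars_initial {P : MvPolynomial (Fin n) K} {i j : Fin n} (h : leadVar P = j)
    (hi : i ∈ (initial P).vars) : i < j := by
  refine lt_of_le_of_ne ((leadVar_eq_coe_iff.1 h).2 i (vars_initial_subset P hi)) ?_
  rintro rfl
  exact notMem_vars_initial h hi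

theorem degreeOf_pos_of_leadVar {P : MvPolynomial (Fin n) K} {j : Fin n} (h : leadVar P = j) :
    0 < degreeOf j P :=
  Nat.pos_of_ne_zero (mem_vars_iff_degreeOf_ne_zero.1 (leadVar_eq_coe_iff.1 h).1)

theorem initial_ne_zero {P : MvPolynomial (Fin n) K} {j : Fin n} (h : leadVar P = j) :
    initial P ≠ 0 := by
  rw [initial_eq h, Ne, Polynomial.leadingCoeff_eq_zero]
  intro h0
  have := degreeOf_pos_of_leadVar h
  rw [← natDegree_toPoly, h0] at this
  simp at this

/-! ### Pseudo-division -/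

/-- Cancel the top term of `p` and induct on the degree. The subring `B` records which variables may
occur in the coefficients of the remainder. -/
theorem exists_pseudoDivision {A : Type*} [CommRing A] (B : Subring A) (s : Polynomial A)
    (hs0 : s ≠ 0) (hs : ∀ k, s.coeff k ∈ B) (p : Polynomial A) (hp : ∀ k, p.coeff k ∈ B) :
    ∃ (m : ℕ) (q r : Polynomial A), Polynomial.C (s.leadingCoeff ^ m) * p = q * s + r ∧
      r.degree < s.degree ∧ ∀ k, r.coeff k ∈ B := by
  induction hN : p.degree using WellFoundedLT.induction generalizing p with
  | _ N ih =>
    by_cases hlt : p.degree < s.degree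
    · exact ⟨0, 0, p, by simp, hlt, hp⟩
    rw [not_lt] at hlt
    have hp0 : p ≠ 0 := by
      rintro rfl
      rw [Polynomial.degree_zero, le_bot_iff, Polynomial.degree_eq_bot] at hlt
      exact hs0 hlt
    set p' := Polynomial.C s.leadingCoeff * p -
      Polynomial.monomial (p.natDegree - s.natDegree) p.leadingCoeff * s with hp'
    have hnat : s.natDegree ≤ p.natDegree := Polynomial.natDegree_le_natDegree hlt
    have hdeg : p'.degree < N := by
      rw [← hN, Polynomial.degree_eq_natDegree hp0, Polynomial.degree_lt_iff_coeff_zero]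
      intro m hm
      have hc : (Polynomial.monomial (p.natDegree - s.natDegree) p.leadingCoeff * s).coeff m =
          p.leadingCoeff * s.coeff (m - (p.natDegree - s.natDegree)) := by
        have : m = (m - (p.natDegree - s.natDegree)) + (p.natDegree - s.natDegree) := by lia
        conv_lhs => rw [this]
        rw [Polynomial.coeff_monomial_mul]
      rw [hp', Polynomial.coeff_sub, Polynomial.coeff_C_mul, hc]
      rcases hm.eq_or_lt with rfl | hm
      · have : p.natDegree - (p.natDegree - s.natDegree) = s.natDegree := by lia
        rw [this, Polynomial.coeff_natDegree, Polynomial.coeff_natDegree]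
        ring
      · rw [Polynomial.coeff_eq_zero_of_natDegree_lt hm,
          Polynomial.coeff_eq_zero_of_natDegree_lt (by lia : s.natDegree < _)]
        ring
    obtain ⟨m, q, r, h1, h2, h3⟩ := ih _ hdeg p' (fun k => by
      rw [hp', Polynomial.coeff_sub, Polynomial.coeff_C_mul]
      refine B.sub_mem (B.mul_mem (hs _) (hp _)) ?_
      rw [Polynomial.coeff_mul]
      refine B.sum_mem fun x _ => B.mul_mem ?_ (hs _)
      rw [Polynomial.coeff_monomial]
      split_ifs
      · exact hp _
      · exact B.zero_mem) rfl
    refine ⟨m + 1, Polynomial.C (s.leadingCoeff ^ m) *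
      Polynomial.monomial (p.natDegree - s.natDegree) p.leadingCoeff + q, r, ?_, h2, h3⟩
    rw [hp', mul_sub] at h1
    rw [pow_succ, Polynomial.C_mul]
    linear_combination h1

theorem toPoly_eval {j : Fin n} {r : Polynomial (MvPolynomial (Fin n) K)}
    (hr : ∀ k, j ∉ (r.coeff k).vars) : toPoly j (r.eval (X j)) = r := by
  conv_rhs => rw [r.as_sum_range_C_mul_X_pow]
  rw [Polynomial.eval_eq_sum_range, map_sum]
  refine Finset.sum_congr rfl fun k _ => ?_
  rw [map_mul, map_pow, toPoly_X, toPoly_eq_C (hr k)]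

/-- Pseudo-division of `P` by `t` in the leading variable `X j` of `t`. -/
theorem exists_initial_pow_mul_eq {t : MvPolynomial (Fin n) K} {j : Fin n}
    (ht : leadVar t = j) (P : MvPolynomial (Fin n) K) {S : Set (Fin n)}
    (htS : (t.vars : Set (Fin n)) ⊆ S) (hPS : (P.vars : Set (Fin n)) ⊆ S) :
    ∃ (m : ℕ) (Q R : MvPolynomial (Fin n) K), initial t ^ m * P = Q * t + R ∧
      degreeOf j R < degreeOf j t ∧ (R.vars : Set (Fin n)) ⊆ S := by
  -- Coefficients free of `X j` are what makes `toPoly j` recover the remainder after evaluation at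
  -- `X j`.
  have hmem : ∀ A : MvPolynomial (Fin n) K, (A.vars : Set (Fin n)) ⊆ S →
      ∀ k, (toPoly j A).coeff k ∈ (supported K (S \ {j})).toSubring := by
    intro A hA k
    rw [coeff_toPoly]
    refine mem_supported.2 fun i hi => ⟨hA (vars_coeffIn_subset j k A hi), ?_⟩
    rintro rfl
    exact notMem_vars_coeffIn _ _ _ hi
  have hpos := degreeOf_pos_of_leadVar ht
  have h0 : toPoly j t ≠ 0 := by
    intro h0
    rw [← natDegree_toPoly, h0] at hpos
    simp at hpos
  obtain ⟨m, q, r, h1, h2, h3⟩ := exists_pseudoDivision (supported K (S \ {j})).toSubring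
    (toPoly j t) h0 (hmem t htS) (toPoly j P) (hmem P hPS)
  have hr : toPoly j (r.eval (X j)) = r :=
    toPoly_eval fun k hk => (mem_supported.1 (h3 k) hk).2 rfl
  refine ⟨m, q.eval (X j), r.eval (X j), ?_, ?_, ?_⟩
  · have := congrArg (Polynomial.eval (X j)) h1
    simpa only [Polynomial.eval_mul, Polynomial.eval_add, Polynomial.eval_C, eval_toPoly,
      ← initial_eq ht] using this
  · rw [← natDegree_toPoly, ← natDegree_toPoly, hr]
    rw [← natDegree_toPoly] at hpos
    by_cases hr0 : r = 0
    · rwa [hr0, Polynomial.natDegree_zero]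
    · exact Polynomial.natDegree_lt_natDegree hr0 h2
  · rw [← mem_supported, Polynomial.eval_eq_sum_range]
    refine Subalgebra.sum_mem _ fun k _ => Subalgebra.mul_mem _
      (supported_mono Set.sdiff_subset (h3 k)) ?_
    have hj : j ∈ S := htS (leadVar_eq_coe_iff.1 ht).1
    exact Subalgebra.pow_mem _ (X_mem_supported.2 hj) _

/-! ### Regular elements modulo an ideal, saturations, and extended ideals -/

/-- `c` is a non-zero-divisor modulo `I`. -/
def RegularModulo {A : Type*} [CommRing A] (I : Ideal A) (c : A) : Prop :=
  ∀ P, c * P ∈ I → P ∈ I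

theorem RegularModulo.mul {A : Type*} [CommRing A] {I : Ideal A} {a b : A}
    (ha : RegularModulo I a) (hb : RegularModulo I b) : RegularModulo I (a * b) := fun P h =>
  hb P (ha _ (by rwa [← mul_assoc]))

theorem RegularModulo.one {A : Type*} [CommRing A] {I : Ideal A} : RegularModulo I 1 :=
  fun P h => by rwa [one_mul] at h

theorem RegularModulo.pow {A : Type*} [CommRing A] {I : Ideal A} {a : A}
    (ha : RegularModulo I a) (k : ℕ) : RegularModulo I (a ^ k) := by
  induction k with
  | zero => rw [pow_zero]; exact .one
  | succ k ih => rw [pow_succ]; exact ih.mul ha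

theorem RegularModulo.of_dvd {A : Type*} [CommRing A] {I : Ideal A} {a b : A}
    (hb : RegularModulo I b) (h : a ∣ b) : RegularModulo I a := by
  obtain ⟨d, rfl⟩ := h
  intro P hP
  refine hb P ?_
  rw [mul_right_comm]
  exact I.mul_mem_right _ hP

theorem RegularModulo.prod {ι A : Type*} [CommRing A] {I : Ideal A} {s : Finset ι} {f : ι → A}
    (h : ∀ i ∈ s, RegularModulo I (f i)) : RegularModulo I (∏ i ∈ s, f i) :=
  Finset.prod_induction f (RegularModulo I) (fun _ _ => .mul) .one h

theorem regularModulo_iff_mem_nonZeroDivisors {A : Type*} [CommRing A] {I : Ideal A} {c : A} :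
    RegularModulo I c ↔ Ideal.Quotient.mk I c ∈ nonZeroDivisors (A ⧸ I) := by
  rw [mem_nonZeroDivisors_iff_right]
  constructor
  · intro h x
    obtain ⟨P, rfl⟩ := Ideal.Quotient.mk_surjective x
    rw [← map_mul, Ideal.Quotient.eq_zero_iff_mem, Ideal.Quotient.eq_zero_iff_mem, mul_comm]
    exact h P
  · intro h P hP
    rw [← Ideal.Quotient.eq_zero_iff_mem]
    apply h
    rwa [← map_mul, Ideal.Quotient.eq_zero_iff_mem, mul_comm]

/-- The elements that some power of `J` multiplies into `I`. -/
def saturation {A : Type*} [CommRing A] (I : Ideal A) (J : A) : Ideal A where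
  carrier := {P | ∃ i : ℕ, P * J ^ i ∈ I}
  zero_mem' := ⟨0, by simp⟩
  add_mem' := by
    rintro P Q ⟨i, hi⟩ ⟨j, hj⟩
    refine ⟨i + j, ?_⟩
    have h : (P + Q) * J ^ (i + j) = J ^ j * (P * J ^ i) + J ^ i * (Q * J ^ j) := by ring
    rw [h]
    exact Ideal.add_mem _ (Ideal.mul_mem_left _ _ hi) (Ideal.mul_mem_left _ _ hj)
  smul_mem' := by
    rintro B P ⟨i, hi⟩
    exact ⟨i, by rw [smul_eq_mul, mul_assoc]; exact Ideal.mul_mem_left _ _ hi⟩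

theorem le_saturation {A : Type*} [CommRing A] (I : Ideal A) (J : A) : I ≤ saturation I J :=
  fun P hP => ⟨0, by simpa using hP⟩

theorem regularModulo_saturation {A : Type*} [CommRing A] (I : Ideal A) (J : A) :
    RegularModulo (saturation I J) J := by
  rintro P ⟨i, hi⟩
  refine ⟨i + 1, ?_⟩
  rwa [pow_succ', ← mul_assoc, mul_comm P]

theorem subset_sat {T : Finset (MvPolynomial (Fin n) K)} {P : MvPolynomial (Fin n) K}
    (hP : P ∈ T) : P ∈ sat T :=
  le_saturation _ _ (Ideal.subset_span hP)

theorem regularModulo_sat_initial {T : Finset (MvPolynomial (Fin n) K)}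
    {P : MvPolynomial (Fin n) K} (hP : P ∈ T) : RegularModulo (sat T) (initial P) :=
  (regularModulo_saturation _ _).of_dvd (Finset.dvd_prod_of_mem _ hP)

/-- Minimality of `sat T`: it is the least ideal containing `T` modulo which all the initials are
regular. -/
theorem sat_le_of_regularModulo {T : Finset (MvPolynomial (Fin n) K)}
    {I : Ideal (MvPolynomial (Fin n) K)} (hT : ∀ P ∈ T, P ∈ I)
    (hreg : ∀ P ∈ T, RegularModulo I (initial P)) : sat T ≤ I := by
  rintro P ⟨i, hi⟩
  refine ((RegularModulo.prod hreg).pow i) P ?_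
  rw [mul_comm]
  exact Ideal.span_le.2 hT hi

theorem sat_mono {S T : Finset (MvPolynomial (Fin n) K)} (h : S ⊆ T) : sat S ≤ sat T :=
  sat_le_of_regularModulo (fun _ hP => subset_sat (h hP))
    fun _ hP => regularModulo_sat_initial (h hP)

theorem sat_empty : sat (∅ : Finset (MvPolynomial (Fin n) K)) = ⊥ := by
  rw [eq_bot_iff]
  exact sat_le_of_regularModulo (by simp) (by simp)

/-- With a polynomial, `I` contains its coefficients with respect to `X j`. -/
def IsExtendedIn (j : Fin n) (I : Ideal (MvPolynomial (Fin n) K)) : Prop :=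
  ∀ P ∈ I, ∀ k, (toPoly j P).coeff k ∈ I

theorem isExtendedIn_span {j : Fin n} {S : Set (MvPolynomial (Fin n) K)}
    (hS : ∀ s ∈ S, j ∉ s.vars) : IsExtendedIn j (Ideal.span S) := by
  intro P hP
  induction hP using Submodule.span_induction with
  | mem s hs =>
    intro k
    rw [toPoly_eq_C (hS s hs), Polynomial.coeff_C]
    split_ifs
    · exact Ideal.subset_span hs
    · exact Ideal.zero_mem _
  | zero => simp
  | add x y _ _ hx hy =>
    intro k
    rw [map_add, Polynomial.coeff_add]
    exact Ideal.add_mem _ (hx k) (hy k)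
  | smul a x _ hx =>
    intro k
    rw [smul_eq_mul, map_mul, Polynomial.coeff_mul]
    exact Ideal.sum_mem _ fun _ _ => Ideal.mul_mem_left _ _ (hx _)

theorem IsExtendedIn.saturation {j : Fin n} {I : Ideal (MvPolynomial (Fin n) K)}
    (hI : IsExtendedIn j I) {J : MvPolynomial (Fin n) K} (hJ : j ∉ J.vars) :
    IsExtendedIn j (saturation I J) := by
  rintro P ⟨i, hi⟩ k
  refine ⟨i, ?_⟩
  have := hI _ hi k
  rwa [map_mul, map_pow, toPoly_eq_C hJ, ← map_pow, Polynomial.coeff_mul_C] at this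

theorem mem_of_coeff_toPoly_mem {I : Ideal (MvPolynomial (Fin n) K)} {P : MvPolynomial (Fin n) K}
    (j : Fin n) (h : ∀ k, (toPoly j P).coeff k ∈ I) : P ∈ I := by
  rw [← eval_toPoly j P, Polynomial.eval_eq_sum_range]
  exact I.sum_mem fun k _ => I.mul_mem_right _ (h k)

/-- Modulo `I`, `P` becomes a multiple `q * t` of `t`. The leading coefficient of `t` is regular
there, so a nonzero `q` would give a product of degree at least that of `t`. That `I` is extended
makes it legitimate to reduce coefficientwise. -/
theorem mem_of_mem_sup_span {j : Fin n} {I : Ideal (MvPolynomial (Fin n) K)}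
    (hI : IsExtendedIn j I) {t P : MvPolynomial (Fin n) K} (ht : leadVar t = j)
    (hc : RegularModulo I (initial t)) (hP : P ∈ I ⊔ Ideal.span {t})
    (hd : degreeOf j P < degreeOf j t) : P ∈ I := by
  obtain ⟨a, ha, b, hb, rfl⟩ := Submodule.mem_sup.1 hP
  obtain ⟨q, rfl⟩ := Ideal.mem_span_singleton'.1 hb
  refine I.add_mem ha (I.mul_mem_right _ ?_)
  set π := Ideal.Quotient.mk I
  set f : MvPolynomial (Fin n) K → Polynomial (MvPolynomial (Fin n) K ⧸ I) :=
    fun p => (toPoly j p).map π with hf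
  have hfa : f a = 0 := by
    ext k
    rw [hf, Polynomial.coeff_map, Polynomial.coeff_zero, Ideal.Quotient.eq_zero_iff_mem]
    exact hI a ha k
  suffices hq : f q = 0 by
    apply mem_of_coeff_toPoly_mem j
    intro k
    rw [← Ideal.Quotient.eq_zero_iff_mem, ← Polynomial.coeff_map]
    change (f q).coeff k = 0
    rw [hq, Polynomial.coeff_zero]
  have hfP : f (a + q * t) = f q * f t := by
    have : f (a + q * t) = f a + f q * f t := by simp [hf]
    rw [this, hfa, zero_add]
  have h1 : (f q * f t).coeff ((f q).natDegree + degreeOf j t) =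
      (f q).leadingCoeff * π (initial t) := by
    rw [Polynomial.coeff_mul_add_eq_of_natDegree_le le_rfl
      (Polynomial.natDegree_map_le.trans (natDegree_toPoly j t).le), Polynomial.coeff_natDegree,
      hf, Polynomial.coeff_map, coeff_toPoly, initial_eq_coeffIn ht]
  rw [← hfP, Polynomial.coeff_eq_zero_of_natDegree_lt] at h1
  · rw [← Polynomial.leadingCoeff_eq_zero]
    obtain ⟨l, hl⟩ := Ideal.Quotient.mk_surjective (f q).leadingCoeff
    rw [← hl] at h1 ⊢
    rw [eq_comm, ← map_mul, Ideal.Quotient.eq_zero_iff_mem, mul_comm] at h1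
    exact Ideal.Quotient.eq_zero_iff_mem.2 (hc _ h1)
  · refine lt_of_le_of_lt (Polynomial.natDegree_map_le.trans (natDegree_toPoly j _).le) ?_
    lia

theorem degreeOf_mul_le_of_notMem_vars {j : Fin n} {P J : MvPolynomial (Fin n) K}
    (hJ : j ∉ J.vars) : degreeOf j (P * J) ≤ degreeOf j P := by
  refine (degreeOf_mul_le j P J).trans ?_
  rw [mem_vars_iff_degreeOf_ne_zero, not_not] at hJ
  rw [hJ, add_zero]

/-! ### Triangular sets and their saturated ideals -/

/-- The elements of `T` are nonconstant and have distinct leading variables: `T` is a triangular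
set or empty. -/
def HasDistinctLeadVars (T : Finset (MvPolynomial (Fin n) K)) : Prop :=
  (∀ P ∈ T, leadVar P ≠ ⊥) ∧ ∀ P ∈ T, ∀ Q ∈ T, leadVar P = leadVar Q → P = Q

theorem HasDistinctLeadVars.subset {S T : Finset (MvPolynomial (Fin n) K)}
    (hT : HasDistinctLeadVars T) (h : S ⊆ T) : HasDistinctLeadVars S :=
  ⟨fun P hP => hT.1 P (h hP), fun P hP Q hQ => hT.2 P (h hP) Q (h hQ)⟩

theorem HasDistinctLeadVars.exists_leadVar_eq {T : Finset (MvPolynomial (Fin n) K)}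
    (hT : HasDistinctLeadVars T) {P : MvPolynomial (Fin n) K} (hP : P ∈ T) :
    ∃ j : Fin n, leadVar P = j := by
  obtain ⟨j, hj⟩ := WithBot.ne_bot_iff_exists.1 (hT.1 P hP)
  exact ⟨j, hj.symm⟩

-- Builds the set up by increasing leading variable; distinctness makes the new leading variable
-- strictly greatest.
@[elab_as_elim]
theorem HasDistinctLeadVars.induction_on [DecidableEq (MvPolynomial (Fin n) K)]
    {p : Finset (MvPolynomial (Fin n) K) → Prop}
    {T : Finset (MvPolynomial (Fin n) K)} (hT : HasDistinctLeadVars T) (empty : p ∅)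
    (insert : ∀ (t : MvPolynomial (Fin n) K) (S : Finset (MvPolynomial (Fin n) K)) (j : Fin n),
      t ∉ S → leadVar t = j → (∀ s ∈ S, leadVar s < j) → insert t S ⊆ T → p S →
        p (insert t S)) : p T := by
  suffices h : ∀ U : Finset (MvPolynomial (Fin n) K), U ⊆ T → p U from h T subset_rfl
  intro U
  refine Finset.induction_on_max_value leadVar U (fun _ => empty) ?_
  · intro t S htS hmax ih hU
    obtain ⟨j, hj⟩ := hT.exists_leadVar_eq (hU (Finset.mem_insert_self t S))
    have hS : S ⊆ T := (Finset.subset_insert _ _).trans hU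
    refine insert t S j htS hj (fun s hs => ?_) hU (ih hS)
    rw [← hj]
    refine lt_of_le_of_ne (hmax s hs) fun h => ?_
    rw [hT.2 s (hS hs) t (hU (Finset.mem_insert_self t S)) h] at hs
    exact htS hs

theorem notMem_vars_of_leadVar_lt {P : MvPolynomial (Fin n) K} {j : Fin n}
    (h : leadVar P < j) : j ∉ P.vars := fun hj =>
  absurd (Finset.le_max hj) (not_le_of_gt h)

theorem notMem_vars_prod {j : Fin n} {T : Finset (MvPolynomial (Fin n) K)}
    (h : ∀ P ∈ T, j ∉ (initial P).vars) : j ∉ (∏ P ∈ T, initial P).vars := by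
  classical
  intro hj
  obtain ⟨P, hP, hjP⟩ := Finset.mem_biUnion.1 (vars_prod (fun P => initial P) hj)
  exact h P hP hjP

theorem notMem_vars_prod_initial {j : Fin n} {S : Finset (MvPolynomial (Fin n) K)}
    (h : ∀ s ∈ S, leadVar s < j) : j ∉ (∏ P ∈ S, initial P).vars :=
  notMem_vars_prod fun P hP hj => notMem_vars_of_leadVar_lt (h P hP) (vars_initial_subset P hj)

theorem isExtendedIn_sat {j : Fin n} {S : Finset (MvPolynomial (Fin n) K)}
    (h : ∀ s ∈ S, leadVar s < j) : IsExtendedIn j (sat S) :=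
  (isExtendedIn_span fun s hs => notMem_vars_of_leadVar_lt (h s hs)).saturation
    (notMem_vars_prod_initial h)

theorem notMem_vars_pow {j : Fin n} {P : MvPolynomial (Fin n) K} (h : j ∉ P.vars) (k : ℕ) :
    j ∉ (P ^ k).vars := fun hj => h (vars_pow P k hj)

theorem notMem_vars_prod_initial_insert [DecidableEq (MvPolynomial (Fin n) K)]
    {t : MvPolynomial (Fin n) K} {S : Finset (MvPolynomial (Fin n) K)} {j : Fin n}
    (ht : leadVar t = j) (hS : ∀ s ∈ S, leadVar s < j) :
    j ∉ (∏ P ∈ insert t S, initial P).vars := by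
  refine notMem_vars_prod fun P hP => ?_
  rcases Finset.mem_insert.1 hP with rfl | hP
  · exact notMem_vars_initial ht
  · exact fun hj => notMem_vars_of_leadVar_lt (hS P hP) (vars_initial_subset P hj)

/-- No initial involves `X j`, so multiplying `P` by a power of their product keeps the degree below
that of `t`, and `mem_of_mem_sup_span` applies. -/
theorem mem_sat_of_mem_sat_insert [DecidableEq (MvPolynomial (Fin n) K)]
    {t P : MvPolynomial (Fin n) K} {S : Finset (MvPolynomial (Fin n) K)} {j : Fin n}
    (htS : t ∉ S) (ht : leadVar t = j) (hS : ∀ s ∈ S, leadVar s < j)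
    (hreg : RegularModulo (sat S) (initial t)) (hP : P ∈ sat (insert t S))
    (hd : degreeOf j P < degreeOf j t) : P ∈ sat S := by
  obtain ⟨k, hk⟩ := hP
  rw [Finset.coe_insert, Ideal.span_insert, sup_comm] at hk
  have h1 := mem_of_mem_sup_span (isExtendedIn_sat hS) ht hreg
    (sup_le_sup (le_saturation _ (∏ Q ∈ S, initial Q)) le_rfl hk)
    (lt_of_le_of_lt (degreeOf_mul_le_of_notMem_vars
      (notMem_vars_pow (notMem_vars_prod_initial_insert ht hS) k)) hd)
  have h2 : RegularModulo (sat S) ((∏ Q ∈ insert t S, initial Q) ^ k) := by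
    rw [Finset.prod_insert htS]
    exact (hreg.mul (regularModulo_saturation _ _)).pow k
  exact h2 P (by rwa [mul_comm])

/-- A polynomial in the parameters is a non-zero-divisor modulo the saturated ideal. -/
theorem regularModulo_sat {T : Finset (MvPolynomial (Fin n) K)} (hT : HasDistinctLeadVars T)
    {f : MvPolynomial (Fin n) K} (f0 : f ≠ 0) (hf : ∀ i ∈ f.vars, ∀ P ∈ T, leadVar P ≠ i) :
    RegularModulo (sat T) f := by
  classical
  revert hf
  refine hT.induction_on ?_ ?_
  · intro _ P hP
    rw [sat_empty, Ideal.mem_bot] at hP ⊢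
    exact (mul_eq_zero.1 hP).resolve_left f0
  · intro t S j htS ht hS _ ih hf
    have hfS := ih fun i hi P hP => hf i hi P (Finset.mem_insert_of_mem hP)
    have hfj : j ∉ f.vars := fun hj => hf j hj t (Finset.mem_insert_self _ _) ht
    set J := ∏ P ∈ insert t S, initial P with hJ
    have hJ' : J = initial t * ∏ P ∈ S, initial P := Finset.prod_insert htS
    -- `S` is saturated by the initial of `t` as well, so that this initial is regular modulo `I`
    -- although the triangular set need not be regular.
    set I := saturation (Ideal.span (S : Set (MvPolynomial (Fin n) K))) J with hI
    have hIext : IsExtendedIn j I :=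
      (isExtendedIn_span fun s hs => notMem_vars_of_leadVar_lt (hS s hs)).saturation
        (notMem_vars_prod_initial_insert ht hS)
    have hc : RegularModulo I (initial t) :=
      (regularModulo_saturation _ J).of_dvd ⟨_, hJ'⟩
    have hfI : RegularModulo I f := by
      rintro P ⟨k, hk⟩
      obtain ⟨m, hm⟩ := hfS (P * initial t ^ k) ⟨k, by
        convert hk using 1
        rw [hJ']
        ring⟩
      refine ⟨k + m, ?_⟩
      convert Ideal.mul_mem_left _ ((∏ P ∈ S, initial P) ^ k * initial t ^ m) hm using 1
      rw [hJ']
      ring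
    rintro P ⟨k, hk⟩
    -- As `f` is free of `X j`, the product `f * R` still has degree below that of `t`. Lying in `I
    -- ⊔ ⟨t⟩`, it lies in `I`, and `f` can be cancelled.
    obtain ⟨m, Q, R, h1, h2, -⟩ := exists_initial_pow_mul_eq ht (P * J ^ k)
      (Set.subset_univ _) (Set.subset_univ _)
    have hfR : f * R ∈ I ⊔ Ideal.span {t} := by
      have : f * R = initial t ^ m * (f * P * J ^ k) - f * Q * t := by
        linear_combination -f * h1
      rw [this]
      refine Ideal.sub_mem _ (Ideal.mul_mem_left _ _ ?_) (Ideal.mul_mem_left _ _ ?_)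
      · rw [Finset.coe_insert, Ideal.span_insert, sup_comm] at hk
        exact sup_le_sup (le_saturation _ J) le_rfl hk
      · exact Ideal.mem_sup_right (Ideal.mem_span_singleton_self t)
    obtain ⟨l, hl⟩ : R ∈ I := by
      refine hfI R (mem_of_mem_sup_span hIext ht hc hfR (lt_of_le_of_lt ?_ h2))
      rw [mul_comm]
      exact degreeOf_mul_le_of_notMem_vars hfj
    have hRT : R ∈ sat (insert t S) :=
      ⟨l, Ideal.span_mono (Finset.coe_subset.2 (Finset.subset_insert t S)) hl⟩
    have htT : t ∈ insert t S := Finset.mem_insert_self _ _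
    have hJreg : RegularModulo (sat (insert t S)) J := regularModulo_saturation _ _
    refine ((regularModulo_sat_initial htT).pow m) P (hJreg.pow k _ ?_)
    have : J ^ k * (initial t ^ m * P) = Q * t + R := by
      rw [← h1]
      ring
    rw [this]
    exact Ideal.add_mem _ (Ideal.mul_mem_left _ _ (subset_sat htT)) hRT

theorem notMem_sat_of_sat_ne_top {T : Finset (MvPolynomial (Fin n) K)} (hT : HasDistinctLeadVars T)
    (hne : sat T ≠ ⊤) {f : MvPolynomial (Fin n) K} (f0 : f ≠ 0)
    (hf : ∀ i ∈ f.vars, ∀ P ∈ T, leadVar P ≠ i) : f ∉ sat T := fun h =>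
  hne ((Ideal.eq_top_iff_one _).2 (regularModulo_sat hT f0 hf 1 (by rwa [mul_one])))

/-! ### Regular sets -/

theorem IsRegularSet.hasDistinctLeadVars {T : Finset (MvPolynomial (Fin n) K)}
    (hT : IsRegularSet T) : HasDistinctLeadVars T := hT.1.2

/-- Elements of `T` with leading variable at least `a` are removed from the top, one at a time, by
`mem_sat_of_mem_sat_insert`. -/
theorem IsRegularSet.mem_sat_filter_lt {T : Finset (MvPolynomial (Fin n) K)} (hT : IsRegularSet T)
    {P : MvPolynomial (Fin n) K} (hP : P ∈ sat T) (a : WithBot (Fin n))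
    (hd : ∀ t ∈ T, ∀ j : Fin n, leadVar t = j → a ≤ j → degreeOf j P < degreeOf j t) :
    P ∈ sat {t ∈ T | leadVar t < a} := by
  classical
  -- Closure of `U` under smaller leading variables ensures that what lies below its top element is
  -- the set occurring in the definition of regularity.
  suffices h : ∀ U ⊆ T, (∀ t ∈ U, ∀ s ∈ T, leadVar s < leadVar t → s ∈ U) → P ∈ sat U →
      P ∈ sat {t ∈ U | leadVar t < a} from h T subset_rfl (fun _ _ s hs _ => hs) hP
  intro U hU
  refine (hT.hasDistinctLeadVars.subset hU).induction_on ?_ ?_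
  · intro _ h
    simpa using h
  · intro t S j htS ht hS hsub ih hlow hPt
    have htT : t ∈ T := hU (hsub (Finset.mem_insert_self _ _))
    by_cases hta : leadVar t < a
    · rwa [Finset.filter_true_of_mem]
      intro s hs
      rcases Finset.mem_insert.1 hs with rfl | hs
      · exact hta
      · exact ((hS s hs).trans_eq ht.symm).trans hta
    · rw [Finset.filter_insert, if_neg hta]
      refine ih (fun s hs r hr hrs => ?_) ?_
      · refine (Finset.mem_insert.1
          (hlow s (Finset.mem_insert_of_mem hs) r hr hrs)).resolve_left ?_
        rintro rfl
        rw [ht] at hrs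
        exact lt_asymm hrs (hS s hs)
      · have hfilter : {Q ∈ T | leadVar Q < leadVar t} = S := by
          ext Q
          rw [Finset.mem_filter]
          constructor
          · rintro ⟨hQ, hlt⟩
            refine (Finset.mem_insert.1
              (hlow t (Finset.mem_insert_self _ _) Q hQ hlt)).resolve_left ?_
            rintro rfl
            exact lt_irrefl _ hlt
          · exact fun hQ => ⟨hU (hsub (Finset.mem_insert_of_mem hQ)),
              (hS Q hQ).trans_eq ht.symm⟩
        have hreg := regularModulo_iff_mem_nonZeroDivisors.2 (hT.2 t htT).2
        rw [hfilter] at hreg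
        exact mem_sat_of_mem_sat_insert htS ht hS hreg hPt
          (hd t htT j ht (by rwa [← ht, ← not_lt]))

theorem IsRegularSet.sat_ne_top {T : Finset (MvPolynomial (Fin n) K)} (hT : IsRegularSet T) :
    sat T ≠ ⊤ := by
  intro h
  have h1 := hT.mem_sat_filter_lt (P := 1) (h ▸ Submodule.mem_top) ⊥ fun t _ j hj _ => by
    rw [← C_1, degreeOf_C]
    exact degreeOf_pos_of_leadVar hj
  simp [sat_empty] at h1

/-- `P` already belongs to the saturated ideal of the elements below `X j`, which is extended in `X
j`. -/
theorem IsRegularSet.coeff_toPoly_mem_sat {T : Finset (MvPolynomial (Fin n) K)}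
    (hT : IsRegularSet T) {t P : MvPolynomial (Fin n) K} {j : Fin n} (ht : t ∈ T)
    (htj : leadVar t = j) (hP : P ∈ sat T) (hPj : ∀ i ∈ P.vars, i ≤ j)
    (hd : degreeOf j P < degreeOf j t) (k : ℕ) : (toPoly j P).coeff k ∈ sat T := by
  have h1 := hT.mem_sat_filter_lt hP j fun s hs i hi hji => by
    rcases (WithBot.coe_le_coe.1 hji).eq_or_lt with rfl | hlt
    · rwa [hT.hasDistinctLeadVars.2 s hs t ht (hi.trans htj.symm)]
    · have : degreeOf i P = 0 := by
        by_contra h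
        exact absurd (hPj i (mem_vars_iff_degreeOf_ne_zero.2 h)) (not_le_of_gt hlt)
      rw [this]
      exact degreeOf_pos_of_leadVar hi
  exact sat_mono (Finset.filter_subset _ _)
    (isExtendedIn_sat (fun s hs => (Finset.mem_filter.1 hs).2) P h1 k)

/-! ### Algebraicity modulo the saturated ideal -/

/-- `A` may have zero-divisors. After scaling by a common denominator `y`, the coefficients are
integral over `k`, so the leading coefficient times `x` is integral; then `y` and the regular factor
are cancelled. -/
theorem isAlgebraic_of_eval_eq_zero {k A : Type*} [CommRing k] [IsDomain k] [CommRing A]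
    [Algebra k A] {x : A} {p : Polynomial A} (hp : ∀ i, IsAlgebraic k (p.coeff i))
    (hlc : p.leadingCoeff ∈ nonZeroDivisors A) (hx : p.eval x = 0) : IsAlgebraic k x := by
  by_cases hinj : Function.Injective (algebraMap k A)
  swap
  · exact (Algebra.isAlgebraic_of_not_injective hinj).1 x
  choose r hr0 hr using fun i => (hp i).exists_integral_multiple
  set y := ∏ i ∈ Finset.range (p.natDegree + 1), r i with hy
  have hy0 : y ≠ 0 := Finset.prod_ne_zero_iff.2 fun i _ => hr0 i
  have hint : ∀ i, IsIntegral k ((y • p).coeff i) := by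
    intro i
    rw [Polynomial.coeff_smul]
    by_cases hi : i ∈ Finset.range (p.natDegree + 1)
    · rw [hy, ← Finset.prod_erase_mul _ _ hi, mul_smul]
      exact (hr i).smul _
    · rw [Polynomial.coeff_eq_zero_of_natDegree_lt (by simpa [Nat.lt_succ_iff] using hi),
        smul_zero]
      exact isIntegral_zero
  have hyp0 : y • p.leadingCoeff ≠ 0 := by
    rw [Algebra.smul_def, Ne, mul_right_mem_nonZeroDivisors_eq_zero_iff hlc]
    exact fun h => hy0 (hinj (h.trans (map_zero _).symm))
  have hdeg : (y • p).natDegree = p.natDegree :=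
    le_antisymm (Polynomial.natDegree_smul_le _ _)
      (Polynomial.le_natDegree_of_ne_zero (by rwa [Polynomial.coeff_smul]))
  have hlc' : (y • p).leadingCoeff = y • p.leadingCoeff := by
    rw [Polynomial.leadingCoeff, hdeg, Polynomial.coeff_smul, Polynomial.leadingCoeff]
  obtain ⟨q, hmap⟩ : ∃ q : Polynomial (integralClosure k A),
      q.map (algebraMap (integralClosure k A) A) = y • p :=
    ⟨(y • p).toSubring (integralClosure k A).toSubring (by
      intro c hc
      obtain ⟨i, _, rfl⟩ := Polynomial.mem_coeffs_iff.1 hc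
      exact hint i), Polynomial.map_toSubring (y • p) (integralClosure k A).toSubring _⟩
  have hqlc : algebraMap (integralClosure k A) A q.leadingCoeff = y • p.leadingCoeff := by
    rw [← hlc', ← hmap, Polynomial.leadingCoeff_map_of_injective Subtype.val_injective]
  have hqx : Polynomial.aeval x q = 0 := by
    rw [Polynomial.aeval_def, Polynomial.eval₂_eq_eval_map, hmap, Polynomial.eval_smul, hx,
      smul_zero]
  have h1 := isIntegral_leadingCoeff_smul q x hqx
  rw [Algebra.smul_def, hqlc, smul_mul_assoc] at h1
  have h2 : IsAlgebraic k (y • (p.leadingCoeff * x)) := (isIntegral_trans (R := k) _ h1).isAlgebraic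
  exact IsAlgebraic.of_mul hlc (hp _) (h2.of_smul (mem_nonZeroDivisors_of_ne_zero hy0))

/-- The parameters of `T`: the variables that are not the leading variable of an element. -/
def params (T : Finset (MvPolynomial (Fin n) K)) : Set (Fin n) := {i | ∀ P ∈ T, leadVar P ≠ i}

theorem notMem_params_iff {T : Finset (MvPolynomial (Fin n) K)} {i : Fin n} :
    i ∉ params T ↔ ∃ P ∈ T, leadVar P = i := by
  simp [params]

theorem isAlgebraic_mk_of_vars {U : Set (Fin n)} {I : Ideal (MvPolynomial (Fin n) K)}
    {P : MvPolynomial (Fin n) K}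
    (h : ∀ i ∈ P.vars, IsAlgebraic (supported K U) (Ideal.Quotient.mk I (X i))) :
    IsAlgebraic (supported K U) (Ideal.Quotient.mk I P) := by
  have hle : supported K (P.vars : Set (Fin n)) ≤
      ((Subalgebra.algebraicClosure (supported K U)
        (MvPolynomial (Fin n) K ⧸ I)).restrictScalars K).comap (Ideal.Quotient.mkₐ K I) := by
    rw [supported_eq_adjoin_X, Algebra.adjoin_le_iff]
    rintro _ ⟨i, hi, rfl⟩
    exact h i hi
  exact hle (mem_supported_vars P)

/-- By induction on the variables: a leading variable is a root of its `t`, whose coefficients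
involve smaller variables and whose initial is regular modulo `sat T`. -/
theorem isAlgebraic_mk_sat {T : Finset (MvPolynomial (Fin n) K)}
    (P : MvPolynomial (Fin n) K) :
    IsAlgebraic (supported K (params T)) (Ideal.Quotient.mk (sat T) P) := by
  refine isAlgebraic_mk_of_vars fun j hjP => ?_
  clear hjP
  induction j using WellFoundedLT.induction with
  | _ j ih =>
  by_cases hj : j ∈ params T
  · exact isAlgebraic_algebraMap
      (⟨X j, X_mem_supported.2 hj⟩ : supported K (params T))
  obtain ⟨t, ht, htj⟩ := notMem_params_iff.1 hj
  have hreg : Ideal.Quotient.mk (sat T) (initial t) ∈ nonZeroDivisors _ :=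
    regularModulo_iff_mem_nonZeroDivisors.1 (regularModulo_sat_initial ht)
  by_cases htop : sat T = ⊤
  · have : Subsingleton (MvPolynomial (Fin n) K ⧸ sat T) :=
      Ideal.Quotient.subsingleton_iff.2 htop
    rw [Subsingleton.elim (Ideal.Quotient.mk (sat T) (X j)) 0]
    exact isAlgebraic_zero
  have : Nontrivial (MvPolynomial (Fin n) K ⧸ sat T) := Ideal.Quotient.nontrivial_iff.2 htop
  have h0 := nonZeroDivisors.ne_zero hreg
  rw [initial_eq htj] at hreg h0
  refine isAlgebraic_of_eval_eq_zero (p := (toPoly j t).map (Ideal.Quotient.mk (sat T)))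
    (fun i => ?_) ?_ ?_
  · rw [Polynomial.coeff_map, coeff_toPoly]
    refine isAlgebraic_mk_of_vars fun l hl => ih l (lt_of_le_of_ne
      ((leadVar_eq_coe_iff.1 htj).2 l (vars_coeffIn_subset _ _ _ hl)) ?_)
    rintro rfl
    exact notMem_vars_coeffIn _ _ _ hl
  · rwa [Polynomial.leadingCoeff_map_of_leadingCoeff_ne_zero _ h0]
  · rw [Polynomial.eval_map_apply, eval_toPoly]
    exact Ideal.Quotient.eq_zero_iff_mem.2 (subset_sat ht)

/-- A regular algebraic element divides a nonzero scalar. The cofactor is a polynomial in `c` over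
the parameters, which bounds its variables. -/
theorem exists_mul_sub_mem_sat {T : Finset (MvPolynomial (Fin n) K)}
    {c : MvPolynomial (Fin n) K} (hc : RegularModulo (sat T) c) {W : Set (Fin n)}
    (hW : params T ⊆ W) (hcW : (c.vars : Set (Fin n)) ⊆ W) :
    ∃ c' h : MvPolynomial (Fin n) K, (c'.vars : Set (Fin n)) ⊆ W ∧
      (h.vars : Set (Fin n)) ⊆ params T ∧ h ≠ 0 ∧ c * c' - h ∈ sat T := by
  obtain ⟨s, hs, h, h0, hcs⟩ := (isAlgebraic_mk_sat c).exists_nonzero_eq_adjoin_mul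
    (regularModulo_iff_mem_nonZeroDivisors.1 hc)
  rw [Algebra.adjoin_singleton_eq_range_aeval] at hs
  obtain ⟨p, rfl⟩ := hs
  refine ⟨Polynomial.aeval c p, h, ?_, mem_supported.1 h.2, fun h' => h0 (Subtype.ext h'), ?_⟩
  · rw [← mem_supported, Polynomial.aeval_eq_sum_range]
    refine Subalgebra.sum_mem _ fun i _ => ?_
    rw [Algebra.smul_def]
    exact Subalgebra.mul_mem _ (supported_mono hW (p.coeff i).2)
      (Subalgebra.pow_mem _ (mem_supported.2 hcW) i)
  · rw [← Ideal.Quotient.eq_zero_iff_mem, map_sub, map_mul, sub_eq_zero]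
    refine Eq.trans ?_ hcs
    congr 1
    exact (Polynomial.aeval_algHom_apply
      (Ideal.Quotient.mkₐ (supported K (params T)) (sat T)) c p).symm

theorem exists_mem_sat_of_notMem_params {T : Finset (MvPolynomial (Fin n) K)}
    {j : Fin n} (hj : j ∉ params T) :
    ∃ g ∈ sat T, g ≠ 0 ∧ (g.vars : Set (Fin n)) ⊆ insert j (params T) := by
  obtain ⟨p, hp0, hp⟩ := isAlgebraic_mk_sat (T := T) (X j)
  have hinj : Function.Injective
      (algebraMap (supported K (params T)) (MvPolynomial (Fin n) K)) := Subtype.val_injective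
  refine ⟨Polynomial.aeval (X j) p, ?_, fun h0 => hp0 ?_, ?_⟩
  · rw [← Ideal.Quotient.eq_zero_iff_mem, ← hp]
    exact (Polynomial.aeval_algHom_apply
      (Ideal.Quotient.mkₐ (supported K (params T)) (sat T)) (X j) p).symm
  · have h1 : toPoly j ((p.map (algebraMap (supported K (params T))
        (MvPolynomial (Fin n) K))).eval (X j)) = p.map (algebraMap _ _) :=
      toPoly_eval fun k hk => by
        rw [Polynomial.coeff_map] at hk
        exact hj (mem_supported.1 (p.coeff k).2 hk)
    rw [Polynomial.eval_map_algebraMap, h0, map_zero] at h1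
    exact (Polynomial.map_eq_zero_iff hinj).1 h1.symm
  · rw [← mem_supported, Polynomial.aeval_eq_sum_range]
    refine Subalgebra.sum_mem _ fun i _ => ?_
    rw [Algebra.smul_def]
    exact Subalgebra.mul_mem _ (supported_mono (Set.subset_insert _ _) (p.coeff i).2)
      (Subalgebra.pow_mem _ (X_mem_supported.2 (Set.mem_insert _ _)) i)

/-! ### Leading monomials in the lexicographic order -/

theorem eq_or_exists_lt_of_lexOrder_le {a b : Fin n →₀ ℕ} (h : a ≼[lexOrder n] b) :
    a = b ∨ ∃ k, (∀ l, k < l → a l = b l) ∧ a k < b k := by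
  rcases eq_or_lt_of_le h with h | h
  · exact Or.inl ((lexOrder n).toSyn.injective h)
  · exact Or.inr (lexOrder_lt_iff.1 h)

theorem ne_zero_of_leadVar {P : MvPolynomial (Fin n) K} {j : Fin n} (h : leadVar P = j) :
    P ≠ 0 := by
  rintro rfl
  simp [leadVar] at h

theorem degree_apply_eq_zero {P : MvPolynomial (Fin n) K} {i : Fin n} (h : i ∉ P.vars) :
    (lexOrder n).degree P i = 0 := by
  by_cases h0 : P = 0
  · simp [h0]
  · exact mem_support_notMem_vars_zero ((lexOrder n).degree_mem_support h0) h

theorem degree_apply_of_leadVar {P : MvPolynomial (Fin n) K} {j : Fin n} (h : leadVar P = j) :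
    (lexOrder n).degree P j = degreeOf j P := by
  have h0 := ne_zero_of_leadVar h
  obtain ⟨s, hs, hsj⟩ : ∃ s ∈ P.support, s j = degreeOf j P := by
    rw [← coeffIn_ne_zero_iff, ← initial_eq_coeffIn h]
    exact initial_ne_zero h
  apply le_antisymm (monomial_le_degreeOf j ((lexOrder n).degree_mem_support h0))
  rw [← hsj]
  rcases eq_or_exists_lt_of_lexOrder_le ((lexOrder n).le_degree hs) with hsD | ⟨k, hk1, hk2⟩
  · rw [hsD]
  · rcases lt_trichotomy k j with hkj | rfl | hkj
    · exact (hk1 j hkj).le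
    · exact hk2.le
    · rw [degree_apply_eq_zero fun hk => absurd ((leadVar_eq_coe_iff.1 h).2 k hk)
        (not_le_of_gt hkj)] at hk2
      exact absurd hk2 (Nat.not_lt_zero _)

theorem erase_degree_mem_support_initial {P : MvPolynomial (Fin n) K} {j : Fin n}
    (h : leadVar P = j) : ((lexOrder n).degree P).erase j ∈ (initial P).support := by
  rw [mem_support_iff, initial_eq_coeffIn h, coeff_coeffIn, if_pos (by simp),
    ← degree_apply_of_leadVar h, Finsupp.erase_add_single, ← mem_support_iff]
  exact (lexOrder n).degree_mem_support (ne_zero_of_leadVar h)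

/-! ### The lexicographic Gröbner basis of the saturated ideal of a regular set -/

theorem IsReducedGroebnerBasis.eq_of_degree_le {σ : Type*} {m : MonomialOrder σ}
    {I : Ideal (MvPolynomial σ K)} {G : Finset (MvPolynomial σ K)}
    (hG : IsReducedGroebnerBasis m I G) {g h : MvPolynomial σ K} (hg : g ∈ G) (hh : h ∈ G)
    {c : σ →₀ ℕ} (hc : c ∈ g.support) (hle : m.degree h ≤ c) : h = g := by
  by_contra hne
  exact hG.2.2 g hg h hh hne c hc hle

/-- Otherwise the initial of `g` lies in `sat T`, so some basis element has a leading monomial that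
is free of `X j` and divides a term of `g`. Reducedness forces it to be `g`, whose leading monomial
involves `X j`. -/
theorem IsRegularSet.degreeOf_le {T G : Finset (MvPolynomial (Fin n) K)} (hT : IsRegularSet T)
    (hG : IsReducedGroebnerBasis (lexOrder n) (sat T) G) {t g : MvPolynomial (Fin n) K}
    {j : Fin n} (ht : t ∈ T) (hg : g ∈ G) (htj : leadVar t = j) (hgj : leadVar g = j) :
    degreeOf j t ≤ degreeOf j g := by
  by_contra hlt
  have hini : initial g ∈ sat T := by
    rw [initial_eq_coeffIn hgj, ← coeff_toPoly]
    exact hT.coeff_toPoly_mem_sat ht htj (hG.1.1 g hg) (leadVar_eq_coe_iff.1 hgj).2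
      (not_le.1 hlt) _
  have h0 := initial_ne_zero hgj
  obtain ⟨h, hh, hle⟩ := hG.exists_degree_le hini h0
  have hs : (lexOrder n).degree (initial g) ∈ (coeffIn j (degreeOf j g) g).support := by
    rw [← initial_eq_coeffIn hgj]
    exact (lexOrder n).degree_mem_support h0
  have hs2 := (add_single_mem_support_of_mem_support_coeffIn hs).2
  rw [hG.eq_of_degree_le hg hh hs2 (hle.trans le_self_add)] at hle
  have h1 := hle j
  rw [degree_apply_of_leadVar hgj, degree_apply_eq_zero (notMem_vars_initial hgj)] at h1
  exact absurd (degreeOf_pos_of_leadVar hgj) (not_lt_of_ge h1)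

theorem mem_params_of_le {T : Finset (MvPolynomial (Fin n) K)}
    (hvar : VariableOrderingCondition T) {i j : Fin n} (hj : j ∈ params T) (hij : i ≤ j) :
    i ∈ params T := by
  by_contra hi
  exact absurd (hvar j i hj (notMem_params_iff.1 hi)) (not_lt_of_ge hij)

theorem IsRegularSet.notMem_sat {T : Finset (MvPolynomial (Fin n) K)} (hT : IsRegularSet T)
    {P : MvPolynomial (Fin n) K} (h0 : P ≠ 0) (hP : (P.vars : Set (Fin n)) ⊆ params T) :
    P ∉ sat T :=
  notMem_sat_of_sat_ne_top hT.hasDistinctLeadVars hT.sat_ne_top h0 fun _ hi => hP hi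

/-- The parameters are an initial segment, so a polynomial whose leading variable is a parameter
involves parameters only and cannot lie in `sat T`. -/
theorem IsRegularSet.exists_leadVar_eq {T : Finset (MvPolynomial (Fin n) K)}
    (hT : IsRegularSet T) (hvar : VariableOrderingCondition T) {P : MvPolynomial (Fin n) K}
    (h0 : P ≠ 0) (hP : P ∈ sat T) :
    ∃ t ∈ T, ∃ j : Fin n, leadVar t = j ∧ leadVar P = j := by
  by_contra! hno
  refine hT.notMem_sat h0 (fun i hi => ?_) hP
  obtain ⟨j, hj⟩ := Finset.max_of_mem hi
  refine mem_params_of_le hvar (j := j) (fun t ht htj => hno t ht j htj hj)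
    (Finset.le_max_of_eq hi hj)

theorem exists_mem_sat_degree {T : Finset (MvPolynomial (Fin n) K)}
    (hvar : VariableOrderingCondition T) {t : MvPolynomial (Fin n) K}
    {j : Fin n} (ht : t ∈ T) (htj : leadVar t = j) :
    ∃ M ∈ sat T, M ≠ 0 ∧ (lexOrder n).degree M j = degreeOf j t ∧
      ∀ i ∉ params T, i ≠ j → (lexOrder n).degree M i = 0 := by
  have hlt : ∀ i ∈ params T, i < j := fun i hi => hvar i j hi ⟨t, ht, htj⟩
  obtain ⟨c, h, hcW, hhU, h0, hch⟩ := exists_mul_sub_mem_sat (regularModulo_sat_initial ht)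
    (W := {i | i < j}) hlt (fun i hi => lt_of_mem_vars_initial htj hi)
  set d := degreeOf j t with hd
  -- The leading coefficient of `c * t` is replaced by `h`, to which it is congruent modulo `sat T`.
  set M := c * t - (initial t * c - h) * X j ^ d with hM
  have hMI : M ∈ sat T :=
    Ideal.sub_mem _ (Ideal.mul_mem_left _ _ (subset_sat ht)) (Ideal.mul_mem_right _ _ hch)
  have hle : supported K {i | i < j} ≤ supported K {i | i ≤ j} :=
    supported_mono fun i (hi : i < j) => hi.le
  have hini : initial t ∈ supported K {i | i < j} :=
    mem_supported.2 fun i hi => lt_of_mem_vars_initial htj hi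
  have hc : c ∈ supported K {i | i < j} := mem_supported.2 hcW
  have hh : h ∈ supported K {i | i < j} := mem_supported.2 (hhU.trans hlt)
  have hdiff : initial t * c - h ∈ supported K {i | i < j} := sub_mem (mul_mem hini hc) hh
  have hMs : M ∈ supported K {i | i ≤ j} := by
    have ht' : t ∈ supported K {i | i ≤ j} := mem_supported.2 (leadVar_eq_coe_iff.1 htj).2
    have hX : X j ∈ supported K {i | i ≤ j} := X_mem_supported.2 (by simp)
    exact sub_mem (mul_mem (hle hc) ht') (mul_mem (hle hdiff) (pow_mem hX d))
  have hfree : ∀ P ∈ supported K {i | i < j}, toPoly j P = Polynomial.C P := fun P hP =>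
    toPoly_eq_C fun hj => lt_irrefl j (mem_supported.1 hP hj)
  have hcoeff : ∀ k, (toPoly j M).coeff k = c * (toPoly j t).coeff k -
      (initial t * c - h) * if k = d then 1 else 0 := by
    intro k
    rw [hM, map_sub, map_mul, map_mul, map_pow, toPoly_X, hfree c hc,
      hfree _ hdiff, Polynomial.coeff_sub,
      Polynomial.coeff_C_mul, Polynomial.coeff_C_mul, Polynomial.coeff_X_pow]
  have hcd : (toPoly j M).coeff d = h := by
    rw [hcoeff, if_pos rfl, coeff_toPoly, hd, ← initial_eq_coeffIn htj]
    ring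
  have hdeg : degreeOf j M = d := by
    rw [← natDegree_toPoly]
    apply le_antisymm
    · rw [Polynomial.natDegree_le_iff_coeff_eq_zero]
      intro N hN
      rw [hcoeff, if_neg hN.ne', Polynomial.coeff_eq_zero_of_natDegree_lt (by
        rwa [natDegree_toPoly])]
      ring
    · exact Polynomial.le_natDegree_of_ne_zero (by rwa [hcd])
  have hMj : leadVar M = j := by
    refine leadVar_eq_coe_iff.2 ⟨?_, fun i hi => mem_supported.1 hMs hi⟩
    rw [mem_vars_iff_degreeOf_ne_zero, hdeg]
    exact (degreeOf_pos_of_leadVar htj).ne'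
  have hMh : initial M = h := by
    rw [initial_eq_coeffIn hMj, hdeg, ← coeff_toPoly, hcd]
  refine ⟨M, hMI, ne_zero_of_leadVar hMj, ?_, fun i hi hij => ?_⟩
  · rw [degree_apply_of_leadVar hMj, hdeg]
  · have := erase_degree_mem_support_initial hMj
    rw [hMh] at this
    have h2 := mem_support_notMem_vars_zero this fun hi' => hi (hhU hi')
    rwa [Finsupp.erase_ne hij] at h2

theorem IsRegularSet.exists_mem_groebnerBasis {T G : Finset (MvPolynomial (Fin n) K)}
    (hT : IsRegularSet T) (hvar : VariableOrderingCondition T)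
    (hG : IsReducedGroebnerBasis (lexOrder n) (sat T) G) {t : MvPolynomial (Fin n) K}
    {j : Fin n} (ht : t ∈ T) (htj : leadVar t = j) :
    ∃ g ∈ G, leadVar g = j ∧ (lexOrder n).degree g j = degreeOf j t ∧
      ∀ i ∉ params T, i ≠ j → (lexOrder n).degree g i = 0 := by
  obtain ⟨M, hM, hM0, hMj, hMi⟩ := exists_mem_sat_degree hvar ht htj
  obtain ⟨g, hg, hle⟩ := hG.exists_degree_le hM hM0
  have hgi : ∀ i ∉ params T, i ≠ j → (lexOrder n).degree g i = 0 := fun i hi hij =>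
    Nat.eq_zero_of_le_zero ((hle i).trans_eq (hMi i hi hij))
  obtain ⟨s, hs, i, hsi, hgvar⟩ := hT.exists_leadVar_eq hvar (hG.2.1 g hg).ne_zero (hG.1.1 g hg)
  -- The leading variable of `g` is not a parameter, and `X j` is the only such variable that its
  -- leading monomial can contain.
  have hij : i = j := by
    by_contra hij
    have h1 := hgi i (notMem_params_iff.2 ⟨s, hs, hsi⟩) hij
    rw [degree_apply_of_leadVar hgvar] at h1
    exact (degreeOf_pos_of_leadVar hgvar).ne' h1
  subst hij
  refine ⟨g, hg, hgvar, le_antisymm ((hle i).trans_eq hMj) ?_, hgi⟩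
  rw [degree_apply_of_leadVar hgvar]
  exact hT.degreeOf_le hG ht hg htj hgvar

/-! ### The W-characteristic set of the saturated ideal of a regular set -/

theorem wCharSet_subset (I : Ideal (MvPolynomial (Fin n) K)) :
    wCharSet I ⊆ reducedGroebnerBasis (lexOrder n) I := Finset.filter_subset _ _

theorem mem_of_mem_wCharSet {I : Ideal (MvPolynomial (Fin n) K)} {c : MvPolynomial (Fin n) K}
    (hc : c ∈ wCharSet I) : c ∈ I :=
  (reducedGroebnerBasis_spec (lexOrder n) I).1.1 c (wCharSet_subset I hc)

theorem ne_zero_of_mem_wCharSet {I : Ideal (MvPolynomial (Fin n) K)} {c : MvPolynomial (Fin n) K}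
    (hc : c ∈ wCharSet I) : c ≠ 0 :=
  ((reducedGroebnerBasis_spec (lexOrder n) I).2.1 c (wCharSet_subset I hc)).ne_zero

theorem exists_mem_wCharSet {I : Ideal (MvPolynomial (Fin n) K)} {g : MvPolynomial (Fin n) K}
    (hg : g ∈ reducedGroebnerBasis (lexOrder n) I) : ∃ c ∈ wCharSet I, leadVar c = leadVar g := by
  classical
  obtain ⟨c, hc, hmin⟩ := Finset.exists_min_image
    {h ∈ reducedGroebnerBasis (lexOrder n) I | leadVar h = leadVar g}
    (fun h => (lexOrder n).toSyn ((lexOrder n).degree h)) ⟨g, by simp [hg]⟩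
  rw [Finset.mem_filter] at hc
  refine ⟨c, Finset.mem_filter.2 ⟨hc.1, fun Q hQ hQc => ?_⟩, hc.2⟩
  exact hmin Q (Finset.mem_filter.2 ⟨hQ, hQc.trans hc.2⟩)

theorem eq_of_mem_wCharSet {I : Ideal (MvPolynomial (Fin n) K)} {P Q : MvPolynomial (Fin n) K}
    (hP : P ∈ wCharSet I) (hQ : Q ∈ wCharSet I) (h : leadVar P = leadVar Q) : P = Q := by
  have hP' := Finset.mem_filter.1 hP
  have hQ' := Finset.mem_filter.1 hQ
  have hdeg : (lexOrder n).degree P = (lexOrder n).degree Q :=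
    (lexOrder n).toSyn.injective (le_antisymm (hP'.2 Q hQ'.1 h.symm) (hQ'.2 P hP'.1 h))
  exact (reducedGroebnerBasis_spec (lexOrder n) I).eq_of_degree_le hQ'.1 hP'.1
    ((lexOrder n).degree_mem_support (ne_zero_of_mem_wCharSet hQ)) hdeg.le

theorem IsRegularSet.wCharSet_spec {T : Finset (MvPolynomial (Fin n) K)} (hT : IsRegularSet T)
    (hvar : VariableOrderingCondition T) {t c : MvPolynomial (Fin n) K} {j : Fin n}
    (ht : t ∈ T) (htj : leadVar t = j) (hc : c ∈ wCharSet (sat T)) (hcj : leadVar c = j) :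
    degreeOf j c = degreeOf j t ∧ ((initial c).vars : Set (Fin n)) ⊆ params T := by
  have hG := reducedGroebnerBasis_spec (lexOrder n) (sat T)
  obtain ⟨hcG, hmin⟩ := Finset.mem_filter.1 hc
  obtain ⟨g, hg, hgj, hgd, hgi⟩ := hT.exists_mem_groebnerBasis hvar hG ht htj
  have hjp : j ∉ params T := notMem_params_iff.2 ⟨t, ht, htj⟩
  have hcd := degree_apply_of_leadVar hcj
  have hle := hT.degreeOf_le hG ht hcG htj hcj
  -- If the leading monomials differ first at a non-parameter `k`, then `c` has the smaller exponent
  -- there: impossible at `j` by `hle`, and elsewhere because that of `g` is zero. So they differ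
  -- only at parameters.
  have hagree : ∀ i ∉ params T, (lexOrder n).degree c i = (lexOrder n).degree g i := by
    intro i hi
    rcases eq_or_exists_lt_of_lexOrder_le (hmin g hg (hgj.trans hcj.symm)) with
      heq | ⟨k, hk1, hk2⟩
    · rw [heq]
    · refine hk1 i (hvar k i ?_ (notMem_params_iff.1 hi))
      by_contra hk
      by_cases hkj : k = j
      · subst hkj
        lia
      · rw [hgi k hk hkj] at hk2
        lia
  have hdeg : degreeOf j c = degreeOf j t := by
    rw [← hcd, hagree j hjp, hgd]
  refine ⟨hdeg, fun i hi => ?_⟩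
  by_contra hip
  rw [initial_eq_coeffIn hcj] at hi
  obtain ⟨s, hs, hsi⟩ := (mem_vars_iff_mem_support i).1 hi
  obtain ⟨hsj, hs2⟩ := add_single_mem_support_of_mem_support_coeffIn hs
  have hsi0 : s i ≠ 0 := Finsupp.mem_support_iff.1 hsi
  have hij : i ≠ j := by
    rintro rfl
    exact hsi0 hsj
  have hci : (lexOrder n).degree c i = 0 := by rw [hagree i hip, hgi i hip hij]
  have hval : (s + Finsupp.single j (degreeOf j c)) i = s i := by
    simp [Finsupp.single_eq_of_ne hij]
  -- A term of `c` of full degree in `X j` is at most the leading monomial, whose only non-parameter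
  -- is `X j`. The first difference is thus at a parameter, so the term agrees with the leading
  -- monomial at `i`.
  rcases eq_or_exists_lt_of_lexOrder_le ((lexOrder n).le_degree hs2) with heq | ⟨k, hk1, hk2⟩
  · rw [← heq, hval] at hci
    exact hsi0 hci
  · have hkp : k ∈ params T := by
      by_contra hk
      by_cases hkj : k = j
      · subst hkj
        rw [hcd, Finsupp.add_apply, Finsupp.single_eq_same] at hk2
        lia
      · rw [hagree k hk, hgi k hk hkj] at hk2
        lia
    have := hk1 i (hvar k i hkp (notMem_params_iff.1 hip))
    rw [hval, hci] at this
    exact hsi0 this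

theorem IsRegularSet.exists_of_mem_wCharSet {T : Finset (MvPolynomial (Fin n) K)}
    (hT : IsRegularSet T) (hvar : VariableOrderingCondition T) {c : MvPolynomial (Fin n) K}
    (hc : c ∈ wCharSet (sat T)) : ∃ t ∈ T, ∃ j : Fin n, leadVar t = j ∧ leadVar c = j :=
  hT.exists_leadVar_eq hvar (ne_zero_of_mem_wCharSet hc) (mem_of_mem_wCharSet hc)

theorem IsRegularSet.initial_spec {T : Finset (MvPolynomial (Fin n) K)}
    (hT : IsRegularSet T) (hvar : VariableOrderingCondition T) {c : MvPolynomial (Fin n) K}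
    (hc : c ∈ wCharSet (sat T)) :
    initial c ≠ 0 ∧ ((initial c).vars : Set (Fin n)) ⊆ params T := by
  obtain ⟨t, ht, j, htj, hcj⟩ := hT.exists_of_mem_wCharSet hvar hc
  exact ⟨initial_ne_zero hcj, (hT.wCharSet_spec hvar ht htj hc hcj).2⟩

theorem IsRegularSet.sat_le_sat_of_subset_wCharSet {T S : Finset (MvPolynomial (Fin n) K)}
    (hT : IsRegularSet T) (hvar : VariableOrderingCondition T) (hS : S ⊆ wCharSet (sat T)) :
    sat S ≤ sat T :=
  sat_le_of_regularModulo (fun _ hc => mem_of_mem_wCharSet (hS hc)) fun _ hc =>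
    regularModulo_sat hT.hasDistinctLeadVars (hT.initial_spec hvar (hS hc)).1
      fun _ hi => (hT.initial_spec hvar (hS hc)).2 hi

theorem IsRegularSet.isRegularSet_wCharSet {T : Finset (MvPolynomial (Fin n) K)}
    (hT : IsRegularSet T) (hvar : VariableOrderingCondition T) :
    IsRegularSet (wCharSet (sat T)) := by
  have htri : HasDistinctLeadVars (wCharSet (sat T)) := by
    refine ⟨fun c hc => ?_, fun P hP Q hQ => eq_of_mem_wCharSet hP hQ⟩
    obtain ⟨t, ht, j, htj, hcj⟩ := hT.exists_of_mem_wCharSet hvar hc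
    rw [hcj]
    exact WithBot.coe_ne_bot
  refine ⟨⟨?_, htri⟩, fun c hc => ?_⟩
  · obtain ⟨t, ht⟩ := hT.1.1
    obtain ⟨j, htj⟩ := hT.hasDistinctLeadVars.exists_leadVar_eq ht
    obtain ⟨g, hg, -⟩ := hT.exists_mem_groebnerBasis hvar
      (reducedGroebnerBasis_spec (lexOrder n) (sat T)) ht htj
    obtain ⟨c, hc, -⟩ := exists_mem_wCharSet hg
    exact ⟨c, hc⟩
  · obtain ⟨h0, hvars⟩ := hT.initial_spec hvar hc
    have hsub : {Q ∈ wCharSet (sat T) | leadVar Q < leadVar c} ⊆ wCharSet (sat T) :=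
      Finset.filter_subset _ _
    constructor
    · rw [Ne, Ideal.Quotient.eq_zero_iff_mem]
      exact fun h => hT.notMem_sat h0 hvars (hT.sat_le_sat_of_subset_wCharSet hvar hsub h)
    · rw [← regularModulo_iff_mem_nonZeroDivisors]
      -- Leading variables of the W-characteristic set are leading variables of `T`, so the
      -- parameters of `T` remain parameters here.
      refine regularModulo_sat (htri.subset hsub) h0 fun i hi P hP hPi => ?_
      obtain ⟨t, ht, j, htj, hPj⟩ := hT.exists_of_mem_wCharSet hvar (hsub hP)
      exact hvars hi t ht (htj.trans (hPj.symm.trans hPi))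

theorem IsRegularSet.mem_sat_wCharSet {T : Finset (MvPolynomial (Fin n) K)}
    (hT : IsRegularSet T) (hvar : VariableOrderingCondition T) (k : ℕ)
    {P : MvPolynomial (Fin n) K} (hP : P ∈ sat T) (hk : ∀ i ∈ P.vars, (i : ℕ) < k) :
    P ∈ sat (wCharSet (sat T)) := by
  induction k generalizing P with
  | zero =>
    by_cases h0 : P = 0
    · rw [h0]
      exact Ideal.zero_mem _
    · exact absurd hP (hT.notMem_sat h0 fun i hi => absurd (hk i hi) (Nat.not_lt_zero _))
  | succ k ih =>
    by_cases h0 : P = 0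
    · rw [h0]
      exact Ideal.zero_mem _
    obtain ⟨t, ht, j, htj, hPj⟩ := hT.exists_leadVar_eq hvar h0 hP
    obtain ⟨g, hg, hgj, -⟩ := hT.exists_mem_groebnerBasis hvar
      (reducedGroebnerBasis_spec (lexOrder n) (sat T)) ht htj
    obtain ⟨c, hc, hcg⟩ := exists_mem_wCharSet hg
    have hcj : leadVar c = j := hcg.trans hgj
    have hjk : (j : ℕ) < k + 1 := hk j (leadVar_eq_coe_iff.1 hPj).1
    obtain ⟨m, Q, R, h1, h2, h3⟩ := exists_initial_pow_mul_eq hcj P (S := {i | i ≤ j})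
      (leadVar_eq_coe_iff.1 hcj).2 (leadVar_eq_coe_iff.1 hPj).2
    have hR : R ∈ sat T := by
      have : R = initial c ^ m * P - Q * c := by rw [h1]; ring
      rw [this]
      exact Ideal.sub_mem _ (Ideal.mul_mem_left _ _ hP)
        (Ideal.mul_mem_left _ _ (mem_of_mem_wCharSet hc))
    -- Equality of the degrees of `c` and `t` makes a remainder modulo `c` reduced with respect to
    -- `t`.
    rw [(hT.wCharSet_spec hvar ht htj hc hcj).1] at h2
    have hR' : R ∈ sat (wCharSet (sat T)) := by
      refine mem_of_coeff_toPoly_mem j fun l => ih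
        (hT.coeff_toPoly_mem_sat ht htj hR (fun i hi => h3 hi) h2 l) fun i hi => ?_
      rw [coeff_toPoly] at hi
      have hij : i < j := lt_of_le_of_ne (h3 (vars_coeffIn_subset _ _ _ hi)) (by
        rintro rfl
        exact notMem_vars_coeffIn _ _ _ hi)
      have : (i : ℕ) < j := hij
      lia
    refine (regularModulo_sat_initial hc).pow m P ?_
    rw [h1]
    exact Ideal.add_mem _ (Ideal.mul_mem_left _ _ (subset_sat hc)) hR'

theorem IsRegularSet.sat_eq_sat_wCharSet {T : Finset (MvPolynomial (Fin n) K)}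
    (hT : IsRegularSet T) (hvar : VariableOrderingCondition T) :
    sat T = sat (wCharSet (sat T)) :=
  le_antisymm (fun _ hP => hT.mem_sat_wCharSet hvar n hP fun i _ => i.2)
    (hT.sat_le_sat_of_subset_wCharSet hvar subset_rfl)

/-! ### Equiprojectable saturated ideals -/

theorem IsTrivialTriangularSet.sat_eq_top {T : Finset (MvPolynomial (Fin n) K)}
    (hT : IsTrivialTriangularSet T) : sat T = ⊤ := by
  obtain ⟨c, hc, rfl⟩ := hT
  exact Ideal.eq_top_of_isUnit_mem _ (subset_sat (Finset.mem_singleton_self _))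
    ((isUnit_iff_ne_zero.2 hc).map C)

/-- An element of `T'` led by a parameter of `T` would be a parameter polynomial in the proper ideal
`sat T`. Conversely, a leading variable of `T` is algebraic over the parameters of `T` modulo the
common ideal, so it cannot be a parameter of `T'`. -/
theorem IsRegularSet.params_eq {T T' : Finset (MvPolynomial (Fin n) K)} (hT' : IsRegularSet T')
    (hT : HasDistinctLeadVars T) (hvar : VariableOrderingCondition T) (h : sat T = sat T') :
    params T' = params T := by
  have hle : params T ⊆ params T' := by
    intro j hj t ht htj
    refine notMem_sat_of_sat_ne_top hT (h ▸ hT'.sat_ne_top) (ne_zero_of_leadVar htj) (fun i hi => ?_)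
      (h ▸ subset_sat ht)
    exact mem_params_of_le hvar hj ((leadVar_eq_coe_iff.1 htj).2 i hi)
  refine Set.Subset.antisymm (fun j hj => ?_) hle
  by_contra hjT
  obtain ⟨g, hg, h0, hvars⟩ := exists_mem_sat_of_notMem_params hjT
  exact hT'.notMem_sat h0 (hvars.trans (Set.insert_subset hj hle)) (h ▸ hg)

theorem VariableOrderingCondition.of_params_eq {T T' : Finset (MvPolynomial (Fin n) K)}
    (hvar : VariableOrderingCondition T) (h : params T' = params T) :
    VariableOrderingCondition T' := by
  intro i j hi hj
  refine hvar i j (h ▸ hi : i ∈ params T) ?_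
  rw [← notMem_params_iff] at hj ⊢
  rwa [← h]

end

end TriSet

theorem corollary3p4 {K : Type*} [Field K] [CharZero K] {n : ℕ}
    (T : Finset (MvPolynomial (Fin n) K))
    (hT : TriSet.IsTriangularSet T ∨ TriSet.IsTrivialTriangularSet T)
    (hvar : TriSet.VariableOrderingCondition T) :
    TriSet.IsEquiprojectable (TriSet.sat T) ↔
      TriSet.IsRegularSet (TriSet.wCharSet (TriSet.sat T)) ∧
        TriSet.sat T = TriSet.sat (TriSet.wCharSet (TriSet.sat T)) := by
  refine ⟨?_, fun h => ⟨_, h⟩⟩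
  rintro ⟨T', hreg, heq⟩
  rcases hT with hT | hT
  · have hvar' := hvar.of_params_eq (hreg.params_eq hT.2 hvar heq)
    rw [heq]
    exact ⟨hreg.isRegularSet_wCharSet hvar', hreg.sat_eq_sat_wCharSet hvar'⟩
  · exact absurd (heq.symm.trans hT.sat_eq_top) hreg.sat_ne_top
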